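/- Let $G$ be a group acting by automorphisms on a finite abelian group $A'$ (written additively), and let $h_f\colon G\times G\to A'$ be a (normalized) 2-cocycle, i.e. $h_f(g_1,g_2)+h_f(g_1g_2,g_3)=h_f(g_1,g_2g_3)+g_1\cdot h_f(g_2,g_3)$ and $h_f(g,e)=h_f(e,g)=0$ for all $g,g_1,g_2,g_3\in G$. Let $1\to A'\to H\to G\to 1$ be an extension of $G$ by $A'$ defined by $h_f$, i.e. equivalent to the natural extension $1\to A'\to (A'\times G,*)\to G\to 1$ with $(a_1,g_1)*(a_2,g_2)=(a_1+g_1\cdot a_2+h_f(g_1,g_2),\,g_1g_2)$. Assume that $h_f$ is strongly non-split in the following sense: for every proper subgroup $A''\lneqq A'$ that is invariant under the action of $G$ (equivalently, normal in $H$), the induced 2-cocycle $\overline{h_f}\colon G\times G\to A'/A''$ is non-split, that is, there is no function $\varphi\colon G\to A'/A''$ with $\varphi(e)=0$ and $\overline{h_f}(g_1,g_2)=\varphi(g_1)+g_1\cdot \varphi(g_2)-\varphi(g_1g_2)$ for all $g_1,g_2\in G$. Then: (1) $G$ has no proper subgroups of finite index if and only if $H$ has no proper subgroups of finite index. (2)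 $G$ is absolutely connected if and only if $H$ is absolutely connected. Here a group $\Gamma$ is called absolutely connected if it is infinite and, for every first-order expansion $\mathcal{G}=(\Gamma,\cdot,\ldots)$ of $\Gamma$ and every monster model $\mathcal{G}^*\succ\mathcal{G}$ with interpretation $\Gamma^*$ of $\Gamma$, the component ${\Gamma^*}^{000}$ exists and equals $\Gamma^*$; that is, for every small set $B$ of parameters, the smallest subgroup of bounded index of $\Gamma^*$ that is invariant under $\mathrm{Aut}(\mathcal{G}^*/B)$ is $\Gamma^*$ itself. A monster model is an elementary extension that is $\kappa$-saturated and strongly $\kappa$-homogeneous for some strong limit cardinal $\kappa$ greater than $\aleph_0$, $|\Gamma|$ and the cardinality of the language; "small" and "bounded" mean "of cardinality less than $\kappa$". -/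

import Mathlib

universe u v w

/-! ### Two-cocycles and the extensions they define -/

/-- A normalized 2-cocycle (factor set) `h : G × G → A` for an action of the group `G` by
automorphisms on the abelian group `A` (written additively). -/
structure TwoCocycle (G : Type u) (A : Type v) [Group G] [AddCommGroup A]
    [DistribMulAction G A] where
  /-- the underlying function -/
  toFun : G → G → A
  cocycle : ∀ g₁ g₂ g₃ : G,
    toFun g₁ g₂ + toFun (g₁ * g₂) g₃ = toFun g₁ (g₂ * g₃) + g₁ • toFun g₂ g₃
  map_one_right : ∀ g : G, toFun g 1 = 0
  map_one_left : ∀ g : G, toFun 1 g = 0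

namespace TwoCocycle

section

variable {G : Type u} {A : Type v} [Group G] [AddCommGroup A] [DistribMulAction G A]

/-- The underlying set `A × G` of the extension of `G` by `A` defined by the 2-cocycle `h`. -/
@[ext]
structure Ext (h : TwoCocycle G A) where
  /-- the coordinate in `A` -/
  left : A
  /-- the coordinate in `G` -/
  right : G

/-- The operation `(a₁, g₁) * (a₂, g₂) = (a₁ + g₁ • a₂ + h (g₁, g₂), g₁ g₂)`. -/
instance (h : TwoCocycle G A) : Mul h.Ext :=
  ⟨fun x y => ⟨x.left + x.right • y.left + h.toFun x.right y.right, x.right * y.right⟩⟩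

instance (h : TwoCocycle G A) : One h.Ext := ⟨⟨0, 1⟩⟩

instance (h : TwoCocycle G A) : Inv h.Ext :=
  ⟨fun x => ⟨-(x.right⁻¹ • x.left) - h.toFun x.right⁻¹ x.right, x.right⁻¹⟩⟩

@[simp] lemma mul_left (h : TwoCocycle G A) (x y : h.Ext) :
    (x * y).left = x.left + x.right • y.left + h.toFun x.right y.right := rfl
@[simp] lemma mul_right (h : TwoCocycle G A) (x y : h.Ext) :
    (x * y).right = x.right * y.right := rfl
@[simp] lemma one_left (h : TwoCocycle G A) : (1 : h.Ext).left = 0 := rfl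
@[simp] lemma one_right (h : TwoCocycle G A) : (1 : h.Ext).right = 1 := rfl
@[simp] lemma inv_left (h : TwoCocycle G A) (x : h.Ext) :
    (x⁻¹).left = -(x.right⁻¹ • x.left) - h.toFun x.right⁻¹ x.right := rfl
@[simp] lemma inv_right (h : TwoCocycle G A) (x : h.Ext) : (x⁻¹).right = x.right⁻¹ := rfl

instance (h : TwoCocycle G A) : Group h.Ext :=
  Group.ofLeftAxioms
    (by
      intro x y z
      ext
      · have := h.cocycle x.right y.right z.right
        simp only [mul_left, mul_right, smul_add, mul_smul]
        rw [add_assoc _ (h.toFun x.right y.right), add_comm (h.toFun x.right y.right),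
          add_assoc _ _ (h.toFun (x.right * y.right) z.right), add_assoc _ (h.toFun x.right y.right),
          this]
        abel
      · simp [mul_assoc])
    (by
      intro x
      ext
      · simp [h.map_one_left]
      · simp)
    (by
      intro x
      ext
      · simp only [mul_left, inv_left, inv_right, one_left]
        abel
      · simp)

/-- The natural extension `1 → A → (A × G, *) → G → 1` defined by the 2-cocycle `h`. -/
def extension (h : TwoCocycle G A) : GroupExtension (Multiplicative A) h.Ext G where
  inl :=
    { toFun := fun a => ⟨a.toAdd, 1⟩
      map_one' := rfl
      map_mul' := by
        intro a b
        ext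
        · simp [h.map_one_left]
        · simp }
  rightHom :=
    { toFun := fun x => x.right
      map_one' := rfl
      map_mul' := fun _ _ => rfl }
  inl_injective := by
    intro a b hab
    exact congrArg Ext.left hab
  range_inl_eq_ker_rightHom := by
    ext x
    constructor
    · rintro ⟨a, rfl⟩
      rfl
    · intro hx
      refine ⟨Multiplicative.ofAdd x.left, ?_⟩
      ext
      · rfl
      · exact (show x.right = 1 from hx).symm
  rightHom_surjective := fun g => ⟨⟨0, g⟩, rfl⟩

/-- The 2-cocycle `h` is split: `h (g₁, g₂) = f g₁ + g₁ • f g₂ - f (g₁ g₂)` for some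
`f : G → A` with `f 1 = 0`. -/
def IsSplit (h : TwoCocycle G A) : Prop :=
  ∃ f : G → A, f 1 = 0 ∧ ∀ g₁ g₂ : G, h.toFun g₁ g₂ = f g₁ + g₁ • f g₂ - f (g₁ * g₂)

/-- The action of `G` on `A ⧸ C` induced by its action on `A`, for a `G`-invariant subgroup `C`. -/
abbrev quotientAction (C : AddSubgroup A) (hC : ∀ (g : G), ∀ a ∈ C, g • a ∈ C) :
    DistribMulAction G (A ⧸ C) where
  smul g := QuotientAddGroup.map C C (DistribSMul.toAddMonoidHom A g) (hC g)
  one_smul x := by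
    induction x using QuotientAddGroup.induction_on with
    | H a => exact congrArg (QuotientAddGroup.mk (s := C)) (one_smul G a)
  mul_smul g₁ g₂ x := by
    induction x using QuotientAddGroup.induction_on with
    | H a => exact congrArg (QuotientAddGroup.mk (s := C)) (mul_smul g₁ g₂ a)
  smul_zero g := map_zero (QuotientAddGroup.map C C (DistribSMul.toAddMonoidHom A g) (hC g))
  smul_add g := map_add (QuotientAddGroup.map C C (DistribSMul.toAddMonoidHom A g) (hC g))

/-- The 2-cocycle `G × G → A ⧸ C` induced by `h`, for a `G`-invariant subgroup `C` of `A`. -/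
def induced (h : TwoCocycle G A) (C : AddSubgroup A) (hC : ∀ (g : G), ∀ a ∈ C, g • a ∈ C) :
    letI := quotientAction C hC
    TwoCocycle G (A ⧸ C) :=
  letI := quotientAction C hC
  { toFun := fun g₁ g₂ => (h.toFun g₁ g₂ : A ⧸ C)
    cocycle := fun g₁ g₂ g₃ => congrArg (QuotientAddGroup.mk (s := C)) (h.cocycle g₁ g₂ g₃)
    map_one_right := fun g => congrArg (QuotientAddGroup.mk (s := C)) (h.map_one_right g)
    map_one_left := fun g => congrArg (QuotientAddGroup.mk (s := C)) (h.map_one_left g) }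

/-- `h` is strongly non-split: for every proper `G`-invariant subgroup `C` of `A` the induced
2-cocycle `G × G → A ⧸ C` is non-split. -/
def IsStronglyNonSplit (h : TwoCocycle G A) : Prop :=
  ∀ (C : AddSubgroup A) (hC : ∀ (g : G), ∀ a ∈ C, g • a ∈ C), C ≠ ⊤ →
    letI := quotientAction C hC
    ¬ (h.induced C hC).IsSplit

end

end TwoCocycle

/-! ### Monster models and absolutely connected groups -/

open FirstOrder Cardinal

/-- A first-order structure `M` is `κ`-saturated: for every set `B` of fewer than `κ` parameters,
every set of formulas in one variable over `B` that is finitely satisfiable in `M` is realized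
in `M`. (The variables `Sum.inl b` stand for the parameters.) -/
def IsSaturatedModel (L : FirstOrder.Language.{u, v}) (M : Type w) [L.Structure M] (κ : Cardinal.{w}) :
    Prop :=
  ∀ B : Set M, #B < κ → ∀ p : Set (L.Formula (B ⊕ Unit)),
    (∀ s ⊆ p, s.Finite →
      ∃ a : M, ∀ φ ∈ s, φ.Realize (Sum.elim (fun b : B => (b : M)) fun _ => a)) →
    ∃ a : M, ∀ φ ∈ p, φ.Realize (Sum.elim (fun b : B => (b : M)) fun _ => a)

/-- A first-order structure `M` is strongly `κ`-homogeneous: every partial elementary map of `M`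
with a domain of cardinality less than `κ` extends to an automorphism of `M`. -/
def IsStronglyHomogeneous (L : FirstOrder.Language.{u, v}) (M : Type w) [L.Structure M] (κ : Cardinal.{w}) :
    Prop :=
  ∀ (B : Set M) (f : B → M), #B < κ →
    (∀ φ : L.Formula B, φ.Realize (fun b : B => (b : M)) ↔ φ.Realize f) →
    ∃ σ : M ≃[L] M, ∀ b : B, σ b = f b

/-- A first-order expansion `(G, ·, …)` of a group `G`: a first-order structure on `G`, in an
arbitrary language, with a binary function symbol interpreted as the multiplication of `G`. -/
structure GroupExpansion (G : Type u) [Group G] where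
  /-- the language -/
  L : FirstOrder.Language.{u, u}
  /-- the structure on `G` -/
  [str : L.Structure G]
  /-- the symbol for multiplication -/
  mul : L.Functions 2
  funMap_mul : ∀ a b : G, FirstOrder.Language.Structure.funMap mul ![a, b] = a * b

attribute [instance] GroupExpansion.str

/-- A monster model of an expansion `(G, ·, …)`: an elementary extension that is `κ`-saturated and
strongly `κ`-homogeneous for a strong limit cardinal `κ` larger than `ℵ₀`, than the cardinality
of the language and than that of `G`. The carrier is the interpretation `G*` of `G`, with
the group operation that interprets the symbol for multiplication. -/
structure MonsterModel {G : Type u} [Group G] (E : GroupExpansion G) where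
  /-- the degree of saturation and homogeneity; "small" and "bounded" mean less than `κ` -/
  κ : Cardinal.{u}
  isStrongLimit : κ.IsStrongLimit
  aleph0_lt : ℵ₀ < κ
  card_language_lt : E.L.card < κ
  card_group_lt : #G < κ
  /-- the interpretation `G*` of `G` -/
  carrier : Type u
  [str : E.L.Structure carrier]
  /-- the group operation of `G*` -/
  [group : Group carrier]
  funMap_mul : ∀ a b : carrier, FirstOrder.Language.Structure.funMap E.mul ![a, b] = a * b
  /-- the elementary embedding of the expansion of `G` -/
  embedding : G ↪ₑ[E.L] carrier
  isSaturated : IsSaturatedModel E.L carrier κ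
  isStronglyHomogeneous : IsStronglyHomogeneous E.L carrier κ

attribute [instance] MonsterModel.str MonsterModel.group

namespace MonsterModel

/-- The subgroups of `G*` of bounded index that are invariant under the automorphisms of the
monster model fixing `B` pointwise. -/
def boundedInvariantSubgroups {G : Type u} [Group G] {E : GroupExpansion G} (M : MonsterModel E)
    (B : Set M.carrier) : Set (Subgroup M.carrier) :=
  {K | #(M.carrier ⧸ K) < M.κ ∧
    ∀ σ : M.carrier ≃[E.L] M.carrier, (∀ b ∈ B, σ b = b) → ∀ x ∈ K, σ x ∈ K}

/-- `K` is the component `G*⁰⁰⁰_B`: the smallest `B`-invariant subgroup of bounded index. -/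
def IsComponent000Over {G : Type u} [Group G] {E : GroupExpansion G} (M : MonsterModel E)
    (B : Set M.carrier) (K : Subgroup M.carrier) : Prop :=
  IsLeast (M.boundedInvariantSubgroups B) K

/-- `G*⁰⁰⁰` exists and equals `K`: for every small set `B` of parameters the component
`G*⁰⁰⁰_B` equals `K`, so that it does not depend on `B`. -/
def IsComponent000 {G : Type u} [Group G] {E : GroupExpansion G} (M : MonsterModel E)
    (K : Subgroup M.carrier) : Prop :=
  ∀ B : Set M.carrier, #B < M.κ → M.IsComponent000Over B K

end MonsterModel

/-- `G`, given with a first-order structure `E`, is definably absolutely connected: `G*⁰⁰⁰`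
exists and equals `G*`, for the interpretation `G*` of `G` in a monster model. -/
def IsDefinablyAbsolutelyConnected {G : Type u} [Group G] (E : GroupExpansion G) : Prop :=
  Infinite G ∧ ∀ M : MonsterModel E, M.IsComponent000 ⊤

/-- `G` is absolutely connected: it is infinite, and definably absolutely connected in every
first-order expansion `(G, ·, …)`. -/
def IsAbsolutelyConnected (G : Type u) [Group G] : Prop :=
  Infinite G ∧ ∀ E : GroupExpansion G, IsDefinablyAbsolutelyConnected E

/-- `G` has no proper subgroups of finite index. -/
def HasNoProperFiniteIndexSubgroup (G : Type u) [Group G] : Prop :=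
  ∀ K : Subgroup G, K.FiniteIndex → K = ⊤

/-!
The connectedness of a group `Γ` in all its expansions is a purely combinatorial property.
For a finite family `s` of subsets of `Γ` let `D s` be the set of quotients `a⁻¹ b` of elements
that lie in the same members of `s`. Then `Γ` is absolutely connected if and only if it is infinite
and has *uniform width*: there is one `N` such that `(D s) ^ N = Γ` for all finite families `s`
(`isAbsolutelyConnected_iff_hasUniformWidth`).

* Uniform width suffices (`HasUniformWidth.isAbsolutelyConnected`). The equation `(D s) ^ N = Γ`,
  for the families `s` defined by finite sets of formulas, is first-order, so it passes to a
  monster model. By saturation, every element of it is then a product of `N` quotients of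
  pairs with the same type over a given small set. If this set contains representatives of all
  cosets of an invariant subgroup `K` of bounded index, then homogeneity shows that these quotients
  lie in `K`.
* Uniform width is necessary. If it fails along a sequence `s n`, in the sense that no finite number
  of the sets `(D (s n)) ^ n` covers `Γ`, then in a monster model of the expansion of `Γ` by all its
  subsets some element avoids all of them. So the quotients of pairs satisfying the
  same predicates generate a proper subgroup, which is invariant and of bounded index
  (`IsAbsolutelyConnected.hasSequentialWidth`). That the sequential form of width implies the uniform
  one follows from the Baire category theorem on a minimal closed invariant set of
  ultrafilters on `Γ` (`HasSequentialWidth.hasUniformWidth`).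

The second point needs a monster model of that expansion
(`GroupExpansion.nonempty_monsterModel`). It is the union of a chain of subsets of one
ultrapower. Its elements are denoted by formal variables: at each stage of a well-ordered index set
there is a variable for each element to be realized, and a transfinite recursion on ultrafilters on
the set of valuations makes the new variables realize all consistent sets of formulas over the
earlier ones. Saturation is immediate, and homogeneity follows by extending partial elementary maps
along the chain.

Both uniform width and the absence of proper subgroups of finite index pass to quotients. They lift
from `G` to `H` by the same argument. For the former, choose a section of `H → G` with values in
`D ^ N`. The traces of the sets `D ^ (N * 3 ^ j)` on the finite kernel stabilize, and where they
do, the trace is a normal subgroup `W` modulo which the section is multiplicative. Since the cocycle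
is strongly non-split, `W` is the whole kernel (`HasUniformWidth.of_isStronglyNonSplitHom`). For the
latter, a subgroup of finite index takes the place of `D ^ N`
(`HasNoProperFiniteIndexSubgroup.of_isStronglyNonSplitHom`).
-/

open scoped Pointwise

/-! ### Widths of quotient sets -/

/-- The set of all quotients `a⁻¹ b` of elements with `r a b`. -/
def quotientSet {Γ : Type*} [Group Γ] (r : Γ → Γ → Prop) : Set Γ :=
  {x | ∃ a b, r a b ∧ a * x = b}

/-- Two elements are indiscernible by the family `s` of sets if they belong to the same
members of `s`. -/
def Indiscernible {X : Type*} (s : Set (Set X)) (a b : X) : Prop :=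
  ∀ P ∈ s, a ∈ P ↔ b ∈ P

/-- There is a single `N` such that for every finite family `s` of subsets, every element
is a product of `N` quotients of pairs of elements that are indiscernible by `s`. -/
def HasUniformWidth (Γ : Type*) [Group Γ] : Prop :=
  ∃ N : ℕ, ∀ s : Set (Set Γ), s.Finite → quotientSet (Indiscernible s) ^ N = Set.univ

/-- For every sequence `s` of finite families of subsets, finitely many of the sets
`quotientSet (Indiscernible (s n)) ^ n` cover the group. -/
def HasSequentialWidth (Γ : Type*) [Group Γ] : Prop :=
  ∀ s : ℕ → Set (Set Γ), (∀ n, (s n).Finite) →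
    ∃ N : ℕ, ∀ g : Γ, ∃ n ≤ N, g ∈ quotientSet (Indiscernible (s n)) ^ n

section QuotientSet

variable {Γ : Type*} [Group Γ]

lemma Indiscernible.symm {X : Type*} {s : Set (Set X)} {a b : X} (h : Indiscernible s a b) :
    Indiscernible s b a := fun P hP => (h P hP).symm

lemma quotientSet_mono {r r' : Γ → Γ → Prop} (h : ∀ a b, r a b → r' a b) :
    quotientSet r ⊆ quotientSet r' := by
  rintro x ⟨a, b, hab, hx⟩
  exact ⟨a, b, h a b hab, hx⟩

lemma quotientSet_pow_mono {r r' : Γ → Γ → Prop} (h : ∀ a b, r a b → r' a b) (n : ℕ) :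
    quotientSet r ^ n ⊆ quotientSet r' ^ n :=
  Set.pow_subset_pow_left (quotientSet_mono h)

lemma one_mem_quotientSet {r : Γ → Γ → Prop} (h : ∀ a, r a a) : (1 : Γ) ∈ quotientSet r :=
  ⟨1, 1, h 1, mul_one 1⟩

lemma quotientSet_inv {r : Γ → Γ → Prop} (h : ∀ a b, r a b → r b a) :
    (quotientSet r)⁻¹ = quotientSet r := by
  ext x
  constructor
  · rintro ⟨a, b, hab, hx⟩
    exact ⟨b, a, h a b hab, by rw [← hx]; simp⟩
  · rintro ⟨a, b, hab, hx⟩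
    exact ⟨b, a, h a b hab, by rw [← hx]; simp⟩

lemma inv_mem_quotientSet_pow {r : Γ → Γ → Prop} (h : ∀ a b, r a b → r b a) {n : ℕ} {x : Γ}
    (hx : x ∈ quotientSet r ^ n) : x⁻¹ ∈ quotientSet r ^ n := by
  rw [← quotientSet_inv h, inv_pow]
  simpa using hx

lemma exists_mem_pow_of_mem_closure {r : Γ → Γ → Prop} (h : ∀ a b, r a b → r b a) {x : Γ}
    (hx : x ∈ Subgroup.closure (quotientSet r)) : ∃ n, x ∈ quotientSet r ^ n := by
  induction hx using Subgroup.closure_induction with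
  | mem x hx => exact ⟨1, by simpa using hx⟩
  | one => exact ⟨0, by simp⟩
  | mul x y _ _ hx hy =>
    obtain ⟨m, hm⟩ := hx
    obtain ⟨n, hn⟩ := hy
    exact ⟨m + n, by rw [pow_add]; exact Set.mul_mem_mul hm hn⟩
  | inv x _ hx =>
    obtain ⟨n, hn⟩ := hx
    exact ⟨n, inv_mem_quotientSet_pow h hn⟩

end QuotientSet

/-! ### Transfer along the extension -/

/-- A surjective homomorphism `π` has no splitting modulo a proper part of its kernel: the only
normal subgroup `W ≤ ker π` modulo which `π` has a multiplicative section is `ker π`. -/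
def IsStronglyNonSplitHom {G H : Type*} [Group G] [Group H] (π : H →* G) : Prop :=
  ∀ W : Subgroup H, W.Normal → W ≤ π.ker → ∀ σ : G → H, (∀ g, π (σ g) = g) →
    (∀ g g', σ g * σ g' * (σ (g * g'))⁻¹ ∈ W) → W = π.ker

/-- A normal subgroup `W` of the extension inside the kernel corresponds to an invariant subgroup
`C` of `A`, and the negative of the first coordinate of a section that is multiplicative modulo `W`
splits the cocycle modulo `C`. -/
lemma TwoCocycle.IsStronglyNonSplit.rightHom {G H : Type u} {A : Type v} [Group G] [Group H]
    [AddCommGroup A] [DistribMulAction G A] {h : TwoCocycle G A}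
    (hns : h.IsStronglyNonSplit) (S : GroupExtension (Multiplicative A) H G)
    (e : S.Equiv h.extension) : IsStronglyNonSplitHom S.rightHom := by
  intro W hW hker σ hσ hmul
  let φ : H ≃* h.Ext := e.toMulEquiv
  have er : ∀ x, (φ x).right = S.rightHom x := fun x => congrFun e.rightHom_comm x
  have ei : ∀ a : A, φ (S.inl (Multiplicative.ofAdd a)) = ⟨a, 1⟩ := fun a =>
    congrFun e.inl_comm (Multiplicative.ofAdd a)
  let C : AddSubgroup A :=
    { carrier := {a | S.inl (Multiplicative.ofAdd a) ∈ W}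
      add_mem' := fun {a b} ha hb => by
        have := W.mul_mem ha hb
        rwa [← map_mul, ← ofAdd_add] at this
      zero_mem' := by simp
      neg_mem' := fun {a} ha => by
        have := W.inv_mem ha
        rwa [← map_inv, ← ofAdd_neg] at this }
  have hCW : ∀ a : A, a ∈ C ↔ S.inl (Multiplicative.ofAdd a) ∈ W := fun a => Iff.rfl
  have hC : ∀ (g : G), ∀ a ∈ C, g • a ∈ C := by
    intro g a ha
    have key : φ.symm ⟨0, g⟩ * S.inl (Multiplicative.ofAdd a) * (φ.symm ⟨0, g⟩)⁻¹ =
        S.inl (Multiplicative.ofAdd (g • a)) := by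
      rw [mul_inv_eq_iff_eq_mul]
      apply φ.injective
      rw [map_mul, map_mul, ei, ei, φ.apply_symm_apply]
      ext
      · simp [h.map_one_left, h.map_one_right]
      · simp
    rw [hCW, ← key]
    exact hW.conj_mem _ ha _
  have hW' : ∀ x ∈ W, φ x = ⟨(φ x).left, 1⟩ := by
    intro x hx
    ext
    · rfl
    · rw [er]
      exact hker hx
  have hleft : ∀ x ∈ W, (φ x).left ∈ C := by
    intro x hx
    rw [hCW]
    convert hx using 1
    apply φ.injective
    rw [ei, ← hW' x hx]
  by_cases hCtop : C = ⊤
  · refine le_antisymm hker fun x hx => ?_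
    rw [← S.range_inl_eq_ker_rightHom] at hx
    obtain ⟨a, rfl⟩ := hx
    have : Multiplicative.toAdd a ∈ C := hCtop ▸ AddSubgroup.mem_top _
    exact this
  · exfalso
    refine hns C hC hCtop ?_
    let t : G → A := fun g => (φ (σ g)).left
    have ht : ∀ g, φ (σ g) = ⟨t g, g⟩ := fun g => by
      ext
      · rfl
      · rw [er, hσ]
    have hdiff : ∀ g g', h.toFun g g' + t g + g • t g' - t (g * g') ∈ C := by
      intro g g'
      have hw := hleft _ (hmul g g')
      set w := σ g * σ g' * (σ (g * g'))⁻¹ with hw_def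
      have h1 : φ w * φ (σ (g * g')) = φ (σ g) * φ (σ g') := by
        rw [← map_mul, ← map_mul, hw_def, inv_mul_cancel_right]
      rw [hW' w (hmul g g'), ht, ht, ht] at h1
      have h2 := congrArg TwoCocycle.Ext.left h1
      simp only [TwoCocycle.mul_left, h.map_one_left, one_smul, add_zero] at h2
      convert hw using 1
      rw [sub_eq_iff_eq_add, h2]
      abel
    refine ⟨fun g => ((-t g : A) : A ⧸ C), ?_, fun g g' => ?_⟩
    · have h11 := hdiff 1 1
      simp only [h.map_one_left, one_smul, mul_one, zero_add, add_sub_cancel_right] at h11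
      exact (QuotientAddGroup.eq_zero_iff _).2 (C.neg_mem h11)
    · change ((h.toFun g g' : A) : A ⧸ C) =
        (((-t g) + g • (-t g') - (-t (g * g')) : A) : A ⧸ C)
      rw [QuotientAddGroup.eq_iff_sub_mem]
      convert hdiff g g' using 1
      rw [smul_neg]
      abel

section Transfer

variable {G H : Type*} [Group G] [Group H] {π : H →* G}

lemma HasNoProperFiniteIndexSubgroup.of_surjective {G H : Type u} [Group G] [Group H]
    {π : H →* G} (hπ : Function.Surjective π)
    (hH : HasNoProperFiniteIndexSubgroup H) : HasNoProperFiniteIndexSubgroup G := by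
  intro K hK
  have : K.comap π = ⊤ :=
    hH _ ⟨by rw [Subgroup.index_comap_of_surjective _ hπ]; exact hK.index_ne_zero⟩
  exact (Subgroup.comap_injective hπ) (by rw [this, Subgroup.comap_top])

/-- Conjugating an element of an abelian kernel by two elements with the same image gives the
same result. -/
lemma conj_eq_conj_of_map_eq (hab : ∀ x ∈ π.ker, ∀ y ∈ π.ker, x * y = y * x) {w n d : H}
    (hw : w ∈ π.ker) (hnd : π n = π d) : n * w * n⁻¹ = d * w * d⁻¹ := by
  have h1 : d⁻¹ * n ∈ π.ker := by simp [MonoidHom.mem_ker, hnd]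
  have h2 := hab _ h1 _ hw
  calc n * w * n⁻¹ = d * ((d⁻¹ * n) * w) * n⁻¹ := by group
    _ = d * w * d⁻¹ := by rw [h2]; group

/-- A finite index subgroup `K` of the extension maps onto `G`, so that a section with values
in `K` is multiplicative modulo the normal subgroup `K ⊓ ker π`. -/
lemma HasNoProperFiniteIndexSubgroup.of_isStronglyNonSplitHom {G H : Type u} [Group G] [Group H]
    {π : H →* G} (hπ : Function.Surjective π)
    (hab : ∀ x ∈ π.ker, ∀ y ∈ π.ker, x * y = y * x) (hns : IsStronglyNonSplitHom π)
    (hG : HasNoProperFiniteIndexSubgroup G) : HasNoProperFiniteIndexSubgroup H := by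
  intro K hK
  have hmap : K.map π = ⊤ := by
    refine hG _ ⟨fun h0 => hK.index_ne_zero ?_⟩
    have := K.index_map_dvd hπ
    rw [h0] at this
    exact Nat.eq_zero_of_zero_dvd this
  have hex : ∀ g, ∃ x ∈ K, π x = g := fun g => by
    have : g ∈ K.map π := hmap ▸ Subgroup.mem_top g
    exact this
  choose σ hσK hσ using hex
  have hW := hns (K ⊓ π.ker) ⟨fun w hw n => ?_⟩ inf_le_right σ hσ fun g g' => ?_
  · refine eq_top_iff.2 fun x _ => ?_
    have hx : (σ (π x))⁻¹ * x ∈ K ⊓ π.ker := by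
      rw [hW]
      simp [MonoidHom.mem_ker, hσ]
    simpa using K.mul_mem (hσK (π x)) hx.1
  · rw [conj_eq_conj_of_map_eq hab hw.2 (hσ (π n)).symm]
    exact ⟨K.mul_mem (K.mul_mem (hσK _) hw.1) (K.inv_mem (hσK _)),
      π.normal_ker.conj_mem _ hw.2 _⟩
  · refine ⟨K.mul_mem (K.mul_mem (hσK _) (hσK _)) (K.inv_mem (hσK _)), ?_⟩
    simp [hσ]

lemma map_quotientSet_pow {r : H → H → Prop} {r' : G → G → Prop}
    (h : ∀ a b, r a b → r' (π a) (π b)) {n : ℕ} {x : H} (hx : x ∈ quotientSet r ^ n) :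
    π x ∈ quotientSet r' ^ n := by
  have h1 : π '' quotientSet r ⊆ quotientSet r' := by
    rintro _ ⟨x, ⟨a, b, hab, hx⟩, rfl⟩
    exact ⟨π a, π b, h a b hab, by rw [← hx, map_mul]⟩
  exact Set.pow_subset_pow_left h1 (Set.image_pow π _ n ▸ Set.mem_image_of_mem π hx)

lemma HasUniformWidth.of_surjective (hπ : Function.Surjective π) (hH : HasUniformWidth H) :
    HasUniformWidth G := by
  obtain ⟨N, hN⟩ := hH
  refine ⟨N, fun s hs => Set.eq_univ_of_forall fun g => ?_⟩
  obtain ⟨x, rfl⟩ := hπ g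
  have hx : x ∈ quotientSet (Indiscernible ((fun P => π ⁻¹' P) '' s)) ^ N :=
    hN _ (hs.image _) ▸ Set.mem_univ x
  refine map_quotientSet_pow (fun a b hr P hP => ?_) hx
  exact hr _ (Set.mem_image_of_mem _ hP)

/-- A monotone family of subsets of a finite set repeats within the first steps. -/
lemma exists_eq_succ_of_monotone {X : Type*} {T : Set X} (hT : T.Finite) {A : ℕ → Set X}
    (hA : Monotone A) (hAT : ∀ j, A j ⊆ T) : ∃ j ≤ T.ncard, A j = A (j + 1) := by
  by_contra! hne
  have hgrow : ∀ j ≤ T.ncard + 1, j ≤ (A j).ncard := by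
    intro j
    induction j with
    | zero => simp
    | succ j ih =>
      intro hj
      have hlt := Set.ncard_lt_ncard ((hA (Nat.le_add_right j 1)).ssubset_of_ne (hne j (by omega)))
        (hT.subset (hAT _))
      have := ih (by omega)
      omega
  have h1 := hgrow _ le_rfl
  have h2 := Set.ncard_le_ncard (hAT (T.ncard + 1)) hT
  omega

/-- The traces of the powers `D ^ (N * 3 ^ j)` on the finite kernel cannot all be different.
Where they stabilize, the trace `W` is a normal subgroup, and a section with values in `D ^ N`
is multiplicative modulo `W`. -/
lemma HasUniformWidth.of_isStronglyNonSplitHom (hπ : Function.Surjective π)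
    (hfin : (π.ker : Set H).Finite) (hab : ∀ x ∈ π.ker, ∀ y ∈ π.ker, x * y = y * x)
    (hns : IsStronglyNonSplitHom π) (hG : HasUniformWidth G) : HasUniformWidth H := by
  obtain ⟨N, hN⟩ := hG
  set q := (π.ker : Set H).ncard
  -- `D ^ N` meets every coset of the kernel, and `D ^ (N * 3 ^ q)` contains the kernel
  refine ⟨2 * (N * 3 ^ q), fun s hs => Set.eq_univ_of_forall fun x => ?_⟩
  set D := quotientSet (Indiscernible s)
  have hD1 : (1 : H) ∈ D := one_mem_quotientSet fun a P _ => Iff.rfl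
  have hDmono : ∀ {a b : ℕ}, a ≤ b → D ^ a ⊆ D ^ b := fun hab =>
    Set.pow_subset_pow_right hD1 hab
  have hDinv : ∀ {a : ℕ} {y : H}, y ∈ D ^ a → y⁻¹ ∈ D ^ a := fun hy =>
    inv_mem_quotientSet_pow (fun _ _ => Indiscernible.symm) hy
  have hDmul : ∀ {a b : ℕ} {y z : H}, y ∈ D ^ a → z ∈ D ^ b → y * z ∈ D ^ (a + b) :=
    fun hy hz => pow_add D _ _ ▸ Set.mul_mem_mul hy hz
  have hlift : ∀ g, ∃ y ∈ D ^ N, π y = g := by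
    obtain ⟨τ, hτ⟩ := hπ.hasRightInverse
    intro g
    have hg : g ∈ quotientSet (Indiscernible ((fun P => τ ⁻¹' P) '' s)) ^ N :=
      hN _ (hs.image _) ▸ Set.mem_univ g
    have hsub : quotientSet (Indiscernible ((fun P => τ ⁻¹' P) '' s)) ⊆ π '' D := by
      rintro _ ⟨a, b, hr, hy⟩
      refine ⟨(τ a)⁻¹ * τ b, ⟨τ a, τ b, fun P hP => ?_, by simp⟩, ?_⟩
      · exact hr _ (Set.mem_image_of_mem _ hP)
      · rw [map_mul, map_inv, hτ, hτ, ← hy]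
        simp
    have := Set.pow_subset_pow_left (n := N) hsub hg
    rw [← Set.image_pow] at this
    exact this
  choose σ hσD hσ using hlift
  obtain ⟨j, hj, hstab⟩ := exists_eq_succ_of_monotone hfin
    (A := fun j => D ^ (N * 3 ^ j) ∩ π.ker)
    (fun a b hab => Set.inter_subset_inter_left _
      (hDmono (Nat.mul_le_mul_left _ (Nat.pow_le_pow_right (by norm_num) hab))))
    (fun j => Set.inter_subset_right)
  set m := N * 3 ^ j with hm
  have hNm : N ≤ m := Nat.le_mul_of_pos_right _ (by positivity)
  have hmq : m ≤ N * 3 ^ q := Nat.mul_le_mul_left _ (Nat.pow_le_pow_right (by norm_num) hj)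
  have hstab' : ∀ y, y ∈ D ^ (3 * m) → y ∈ π.ker → y ∈ D ^ m := by
    intro y hy hyk
    have hy' : y ∈ D ^ (N * 3 ^ (j + 1)) ∩ π.ker := by
      refine ⟨?_, hyk⟩
      convert hy using 2
      rw [hm, pow_succ]
      ring
    exact (hstab.symm ▸ hy' : y ∈ D ^ m ∩ π.ker).1
  let W : Subgroup H :=
    { carrier := D ^ m ∩ π.ker
      mul_mem' := fun {a b} ha hb =>
        ⟨hstab' _ (hDmono (by omega) (hDmul ha.1 hb.1)) (π.ker.mul_mem ha.2 hb.2),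
          π.ker.mul_mem ha.2 hb.2⟩
      one_mem' := ⟨Set.one_mem_pow hD1, π.ker.one_mem⟩
      inv_mem' := fun {a} ha => ⟨hDinv ha.1, π.ker.inv_mem ha.2⟩ }
  have hW := hns W ⟨fun w hw n => ?_⟩ (fun y hy => hy.2) σ hσ fun g g' => ?_
  · have hx : (σ (π x))⁻¹ * x ∈ W := by
      rw [hW]
      simp [MonoidHom.mem_ker, hσ]
    have := hDmul (hσD (π x)) hx.1
    rw [mul_inv_cancel_left] at this
    exact hDmono (by omega) this
  · rw [conj_eq_conj_of_map_eq hab hw.2 (hσ (π n)).symm]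
    have hk := π.normal_ker.conj_mem _ hw.2 (σ (π n))
    exact ⟨hstab' _ (hDmono (by omega) (hDmul (hDmul (hσD (π n)) hw.1) (hDinv (hσD (π n))))) hk,
      hk⟩
  · have hk : σ g * σ g' * (σ (g * g'))⁻¹ ∈ π.ker := by simp [MonoidHom.mem_ker, hσ]
    exact ⟨hstab' _ (hDmono (by omega) (hDmul (hDmul (hσD _) (hσD _)) (hDinv (hσD _)))) hk, hk⟩

end Transfer

/-! ### Uniformity of the width -/

section Uniformity

variable {Γ : Type*} [Group Γ]

/-- The translate of an ultrafilter on a group by an element. -/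
def Ultrafilter.translate (g : Γ) (q : Ultrafilter Γ) : Ultrafilter Γ := q.map (g * ·)

lemma Ultrafilter.mem_translate {g : Γ} {q : Ultrafilter Γ} {P : Set Γ} :
    P ∈ q.translate g ↔ (g * ·) ⁻¹' P ∈ q := Iff.rfl

lemma Ultrafilter.translate_translate (g g' : Γ) (q : Ultrafilter Γ) :
    (q.translate g').translate g = q.translate (g * g') := by
  ext P
  simp only [Ultrafilter.mem_translate, ← Set.preimage_comp]
  rw [show ((g * ·) ∘ (g' * ·) : Γ → Γ) = (g * g' * ·) from funext fun x => (mul_assoc _ _ _).symm]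

lemma Ultrafilter.translate_one (q : Ultrafilter Γ) : q.translate 1 = q := by
  ext P
  simp [Ultrafilter.mem_translate]

lemma Ultrafilter.continuous_translate (g : Γ) :
    Continuous (Ultrafilter.translate g : Ultrafilter Γ → Ultrafilter Γ) := by
  refine continuous_generateFrom_iff.2 ?_
  rintro _ ⟨P, rfl⟩
  exact ultrafilter_isOpen_basic ((g * ·) ⁻¹' P)

/-- There is a nonempty closed set of ultrafilters on a group, invariant under translations,
all of whose orbits are dense. -/
lemma Ultrafilter.exists_minimal_invariant (Γ : Type*) [Group Γ] :
    ∃ I : Set (Ultrafilter Γ), I.Nonempty ∧ IsClosed I ∧ (∀ g, ∀ q ∈ I, q.translate g ∈ I) ∧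
      ∀ U : Set (Ultrafilter Γ), IsOpen U → (I ∩ U).Nonempty →
        ∀ q ∈ I, ∃ g : Γ, q.translate g ∈ U := by
  let F : Set (Set (Ultrafilter Γ)) :=
    {I | I.Nonempty ∧ IsClosed I ∧ ∀ g, ∀ q ∈ I, q.translate g ∈ I}
  obtain ⟨I, hI⟩ : ∃ I, Minimal (· ∈ F) I := by
    refine zorn_superset F fun c hc hchain => ?_
    rcases c.eq_empty_or_nonempty with rfl | hne
    · exact ⟨Set.univ, ⟨Set.univ_nonempty, isClosed_univ, fun _ _ _ => trivial⟩, by simp⟩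
    · refine ⟨⋂₀ c, ⟨?_, isClosed_sInter fun t ht => (hc ht).2.1, fun g q hq t ht =>
        (hc ht).2.2 g q (hq t ht)⟩, fun t ht => Set.sInter_subset_of_mem ht⟩
      have : Nonempty c := hne.to_subtype
      rw [Set.sInter_eq_iInter]
      refine IsCompact.nonempty_iInter_of_directed_nonempty_isCompact_isClosed _ ?_
        (fun t => (hc t.2).1) (fun t => (hc t.2).2.1.isCompact) (fun t => (hc t.2).2.1)
      rintro ⟨s, hs⟩ ⟨t, ht⟩
      rcases hchain.total hs ht with h | h
      · exact ⟨⟨s, hs⟩, subset_rfl, h⟩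
      · exact ⟨⟨t, ht⟩, h, subset_rfl⟩
  refine ⟨I, hI.prop.1, hI.prop.2.1, hI.prop.2.2, fun U hU hIU q hq => ?_⟩
  by_contra! hout
  -- the points whose orbits avoid `U` form a smaller closed invariant set
  let V : Set (Ultrafilter Γ) := {p ∈ I | ∀ g : Γ, p.translate g ∉ U}
  have hV : V ∈ F := by
    refine ⟨⟨q, hq, hout⟩, ?_, fun g p hp => ⟨hI.prop.2.2 g p hp.1, fun g' => ?_⟩⟩
    · have : V = I ∩ ⋂ g : Γ, Ultrafilter.translate g ⁻¹' Uᶜ := by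
        ext p
        simp [V]
      rw [this]
      exact hI.prop.2.1.inter (isClosed_iInter fun g =>
        hU.isClosed_compl.preimage (Ultrafilter.continuous_translate g))
    · rw [Ultrafilter.translate_translate]
      exact hp.2 _
  obtain ⟨p, hpI, hpU⟩ := hIU
  have := (hI.le_of_le hV fun p hp => hp.1 : I ⊆ V) hpI
  exact this.2 1 (by rwa [Ultrafilter.translate_one])

/-- On a minimal closed invariant set of ultrafilters, the Baire category theorem gives one
exponent that works for an open set of ultrafilters; finitely many translates of it cover the
minimal set, and every group element is a quotient of two elements that are large for an
ultrafilter in that set. -/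
theorem HasSequentialWidth.hasUniformWidth (h : HasSequentialWidth Γ) : HasUniformWidth Γ := by
  classical
  have hone : ∀ s : Set (Set Γ), (1 : Γ) ∈ quotientSet (Indiscernible s) := fun s =>
    one_mem_quotientSet fun a P _ => Iff.rfl
  have hmono : ∀ (s : Set (Set Γ)) {a b : ℕ}, a ≤ b →
      quotientSet (Indiscernible s) ^ a ⊆ quotientSet (Indiscernible s) ^ b := fun s _ _ hab =>
    Set.pow_subset_pow_right (hone s) hab
  -- `F n` is the closed set of ultrafilters concentrated on all `n`-th powers
  let F : ℕ → Set (Ultrafilter Γ) := fun n =>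
    {q | ∀ s : Set (Set Γ), s.Finite → quotientSet (Indiscernible s) ^ n ∈ q}
  have hFmono : ∀ {a b : ℕ}, a ≤ b → F a ⊆ F b := fun hab q hq s hs =>
    Filter.mem_of_superset (hq s hs) (hmono s hab)
  have hFclosed : ∀ n, IsClosed (F n) := fun n => by
    have : F n = ⋂ s : {s : Set (Set Γ) // s.Finite},
        {q | quotientSet (Indiscernible s.1) ^ n ∈ q} := by
      ext q
      simp [F]
    rw [this]
    exact isClosed_iInter fun s => ultrafilter_isClosed_basic _
  have hFcover : ∀ q : Ultrafilter Γ, ∃ n, q ∈ F n := by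
    intro q
    by_contra! hq
    simp only [F, Set.mem_ofPred_eq, not_forall] at hq
    choose s hs hsq using hq
    obtain ⟨N, hN⟩ := h s hs
    have : ∀ᶠ g in (q : Filter Γ), ∀ n ∈ Finset.range (N + 1),
        g ∉ quotientSet (Indiscernible (s n)) ^ n :=
      (Filter.eventually_all_finset _).2 fun n _ => Ultrafilter.compl_mem_iff_notMem.2 (hsq n)
    obtain ⟨g, hg⟩ := this.exists
    obtain ⟨n, hn, hgn⟩ := hN g
    exact hg n (Finset.mem_range.2 (by omega)) hgn
  have hFmul : ∀ {a b : ℕ} {g : Γ} {q : Ultrafilter Γ},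
      (∀ s : Set (Set Γ), s.Finite → g ∈ quotientSet (Indiscernible s) ^ a) → q ∈ F b →
        q.translate g ∈ F (a + b) := by
    intro a b g q hg hq s hs
    rw [Ultrafilter.mem_translate]
    refine Filter.mem_of_superset (hq s hs) fun x hx => ?_
    rw [Set.mem_preimage, pow_add]
    exact Set.mul_mem_mul (hg s hs) hx
  have hpoint : ∀ g : Γ, ∃ m, ∀ s : Set (Set Γ), s.Finite →
      g ∈ quotientSet (Indiscernible s) ^ m := by
    intro g
    obtain ⟨m, hm⟩ := hFcover (pure g)
    exact ⟨m, fun s hs => hm s hs⟩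
  obtain ⟨I, hIne, hIclosed, hIinv, hImin⟩ := Ultrafilter.exists_minimal_invariant Γ
  have : Nonempty I := hIne.to_subtype
  have : CompactSpace I := isCompact_iff_compactSpace.1 hIclosed.isCompact
  obtain ⟨n, x, hx⟩ := nonempty_interior_of_iUnion_of_closed
    (f := fun n => ((↑) : I → Ultrafilter Γ) ⁻¹' F n)
    (fun n => (hFclosed n).preimage continuous_subtype_val)
    (Set.eq_univ_of_forall fun q => Set.mem_iUnion.2 (hFcover q))
  obtain ⟨V, hVF, hVopen, hxV⟩ := mem_interior.1 hx
  obtain ⟨U, hUopen, rfl⟩ := isOpen_induced_iff.1 hVopen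
  have hUF : ∀ q ∈ I, q ∈ U → q ∈ F n := fun q hq hqU => hVF (show (⟨q, hq⟩ : I) ∈ _ from hqU)
  -- finitely many translates of `U` cover `I`
  obtain ⟨t, ht⟩ := hIclosed.isCompact.elim_finite_subcover
    (fun g : Γ => Ultrafilter.translate g ⁻¹' U)
    (fun g => hUopen.preimage (Ultrafilter.continuous_translate g))
    (fun q hq => Set.mem_iUnion.2 (hImin U hUopen ⟨x, x.2, hxV⟩ q hq))
  choose m hm using hpoint
  have hIF : I ⊆ F (t.sup (fun g => m g⁻¹) + n) := by
    intro q hq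
    obtain ⟨g, hgt, hgU⟩ : ∃ g ∈ t, q.translate g ∈ U := by simpa using ht hq
    have h1 := hFmul (hm g⁻¹) (hUF _ (hIinv g q hq) hgU)
    rw [Ultrafilter.translate_translate, inv_mul_cancel, Ultrafilter.translate_one] at h1
    exact hFmono (Nat.add_le_add_right (Finset.le_sup (f := fun g => m g⁻¹) hgt) n) h1
  set M := t.sup (fun g => m g⁻¹) + n
  refine ⟨M + M, fun s hs => Set.eq_univ_of_forall fun g => ?_⟩
  have h1 := hIF x.2 s hs
  have h2 := hIF (hIinv g _ x.2) s hs
  -- a common element `y` of the two large sets gives `g = (g * y) * y⁻¹`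
  obtain ⟨y, hy1, hy2⟩ := (x : Ultrafilter Γ).nonempty_of_mem (Filter.inter_mem h1 h2)
  have h3 := Set.mul_mem_mul (show g * y ∈ quotientSet (Indiscernible s) ^ M from hy2)
    (inv_mem_quotientSet_pow (fun _ _ h => h.symm) hy1)
  rwa [mul_inv_cancel_right, ← pow_add] at h3

end Uniformity

/-! ### Formulas for powers of quotient sets -/

namespace FirstOrder.Language

open Structure

section Formulas

variable {L : Language.{u, v}}

/-- Existential quantification over an arbitrary family of variables is expressible by a formula,
because only finitely many of them occur. -/
lemma Formula.exists_realize_iff_exists {α β : Type*} (φ : L.Formula (α ⊕ β)) :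
    ∃ θ : L.Formula β, ∀ (M : Type w) [L.Structure M] [Nonempty M] (v : β → M),
      θ.Realize v ↔ ∃ x : α → M, φ.Realize (Sum.elim x v) := by
  classical
  let A₀ : Finset α := φ.freeVarFinset.toLeft
  let ψ : L.Formula (β ⊕ A₀) := φ.restrictFreeVar fun z =>
    Sum.casesOn (motive := fun y => y ∈ φ.freeVarFinset → β ⊕ A₀) z.1
      (fun a ha => Sum.inr ⟨a, by simpa [A₀] using ha⟩) (fun b _ => Sum.inl b) z.2
  have hψ : ∀ (M : Type w) [L.Structure M] (v : β → M) (x : α → M) (y : A₀ → M),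
      (∀ a, y a = x a) → (ψ.Realize (Sum.elim v y) ↔ φ.Realize (Sum.elim x v)) := by
    intro M _ v x y hxy
    refine BoundedFormula.realize_restrictFreeVar _ ?_
    rintro ⟨a | b, h⟩
    · exact hxy _
    · rfl
  refine ⟨ψ.iExs A₀, fun M _ _ v => ?_⟩
  rw [Formula.realize_iExs]
  constructor
  · rintro ⟨y, hy⟩
    refine ⟨fun a => if h : a ∈ A₀ then y ⟨a, h⟩ else Classical.arbitrary M, ?_⟩
    exact (hψ M v _ y fun a => by simp).1 hy
  · rintro ⟨x, hx⟩
    exact ⟨fun a => x a, (hψ M v x _ fun a => rfl).2 hx⟩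

/-- Only finitely many variables occur in a formula. -/
lemma Formula.exists_fin_realize_iff {α : Type*} (φ : L.Formula α) :
    ∃ (n : ℕ) (t : Fin n → α) (ψ : L.Formula (Fin n)),
      ∀ (M : Type w) [L.Structure M] (v : α → M), ψ.Realize (v ∘ t) ↔ φ.Realize v := by
  classical
  let e := φ.freeVarFinset.equivFin
  refine ⟨_, fun i => (e.symm i : α), φ.restrictFreeVar e, fun M _ v => ?_⟩
  exact BoundedFormula.realize_restrictFreeVar _ fun a => by simp

/-- A formula satisfiable in an elementary extension is satisfiable. -/
lemma ElementaryEmbedding.exists_realize {M N : Type w} [L.Structure M] [L.Structure N]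
    [Nonempty M] (f : M ↪ₑ[L] N) {α : Type*} (φ : L.Formula α) {v : α → N} (h : φ.Realize v) :
    ∃ v' : α → M, φ.Realize v' := by
  have : Nonempty N := ‹Nonempty M›.map f
  obtain ⟨θ, hθ⟩ := (φ.relabel Sum.inl : L.Formula (α ⊕ Empty)).exists_realize_iff_exists
  have hN : θ.Realize (f ∘ (Empty.elim : Empty → M)) :=
    (hθ N _).2 ⟨v, by rwa [Formula.realize_relabel, Sum.elim_comp_inl]⟩
  rw [f.map_formula] at hN
  obtain ⟨x, hx⟩ := (hθ M _).1 hN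
  exact ⟨x, by rwa [Formula.realize_relabel, Sum.elim_comp_inl] at hx⟩

/-- The formula saying that its two distinguished variables satisfy the same formulas of the
finite set `s`. -/
noncomputable def agreeFormula {Y : Type*} (s : Set (L.Formula (Y ⊕ Unit))) [Finite s] :
    L.Formula (Y ⊕ Bool) :=
  Formula.iInf fun φ : s =>
    (φ.1.relabel (Sum.map id fun _ => false)).iff (φ.1.relabel (Sum.map id fun _ => true))

/-- Two elements satisfy the same formulas of `s` with parameters `y`. -/
def SameType {M Y : Type*} [L.Structure M] (s : Set (L.Formula (Y ⊕ Unit))) (y : Y → M)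
    (a b : M) : Prop :=
  ∀ φ ∈ s, φ.Realize (Sum.elim y fun _ => a) ↔ φ.Realize (Sum.elim y fun _ => b)

lemma realize_agreeFormula {M Y : Type*} [L.Structure M] (s : Set (L.Formula (Y ⊕ Unit)))
    [Finite s] (y : Y → M) (z : Bool → M) :
    (agreeFormula s).Realize (Sum.elim y z) ↔ SameType s y (z false) (z true) := by
  simp only [agreeFormula, Formula.realize_iInf, Formula.realize_iff, Formula.realize_relabel,
    Sum.elim_comp_map, Function.comp_id, SameType, Subtype.forall]
  rfl

/-- The formula saying that its distinguished variable is a product of `n` quotients of pairs of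
elements satisfying the same formulas of the finite set `s`. -/
noncomputable def powFormula (m : L.Functions 2) {Y : Type*} (s : Set (L.Formula (Y ⊕ Unit)))
    [Finite s] : ℕ → L.Formula (Y ⊕ Unit)
  -- `x * x = x` says that `x` is the identity, for which the language has no symbol
  | 0 => Term.equal (m.apply₂ (Term.var (Sum.inr ())) (Term.var (Sum.inr ())))
      (Term.var (Sum.inr ()))
  | n + 1 =>
    ((powFormula m s n).relabel
        (Sum.elim (fun y => Sum.inl (Sum.inl y)) fun _ => Sum.inr 0 :
          Y ⊕ Unit → (Y ⊕ Unit) ⊕ Fin 3) ⊓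
      ((agreeFormula s).relabel
        (Sum.elim (fun y => Sum.inl (Sum.inl y)) fun b => Sum.inr (if b then 2 else 1)) ⊓
      Term.equal (m.apply₂ (Term.var (Sum.inr 1)) (Term.var (Sum.inl (Sum.inr ()))))
        (m.apply₂ (Term.var (Sum.inr 2)) (Term.var (Sum.inr 0))))).iExs (Fin 3)

lemma realize_powFormula {M Y : Type*} [L.Structure M] [Group M] {m : L.Functions 2}
    (hm : ∀ a b : M, funMap m ![a, b] = a * b) (s : Set (L.Formula (Y ⊕ Unit)))
    [Finite s] (y : Y → M) (n : ℕ) (g : M) :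
    (powFormula m s n).Realize (Sum.elim y fun _ => g) ↔
      g ∈ quotientSet (SameType s y) ^ n := by
  induction n generalizing g with
  | zero =>
    simp [powFormula, hm]
  | succ n ih =>
    have h0 : ∀ i : Fin 3 → M, (Sum.elim (Sum.elim y fun _ => g) i) ∘
        (Sum.elim (fun y => Sum.inl (Sum.inl y)) fun _ => Sum.inr 0 :
          Y ⊕ Unit → (Y ⊕ Unit) ⊕ Fin 3) = Sum.elim y fun _ => i 0 := fun i => by
      ext (_ | _) <;> rfl
    have h1 : ∀ i : Fin 3 → M, (Sum.elim (Sum.elim y fun _ => g) i) ∘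
        (Sum.elim (fun y => Sum.inl (Sum.inl y)) fun b => Sum.inr (if b then 2 else 1) :
          Y ⊕ Bool → (Y ⊕ Unit) ⊕ Fin 3) = Sum.elim y fun b => if b then i 2 else i 1 :=
        fun i => by
      ext (_ | _ | _) <;> rfl
    simp only [powFormula, Formula.realize_iExs, Formula.realize_inf, Formula.realize_relabel,
      h0, h1, ih, realize_agreeFormula, Formula.realize_equal,
      Term.realize_functions_apply₂, Term.realize_var, Sum.elim_inr, Sum.elim_inl, hm]
    rw [pow_succ', Set.mem_mul]
    constructor
    · rintro ⟨i, hz, hab, heq⟩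
      refine ⟨(i 1)⁻¹ * i 2, ⟨i 1, i 2, by simpa using hab, by simp⟩, i 0, hz, ?_⟩
      rw [mul_assoc, ← heq, inv_mul_cancel_left]
    · rintro ⟨d, ⟨a, b, hab, rfl⟩, z, hz, rfl⟩
      exact ⟨![z, a, a * d], hz, by simpa using hab, by simp [mul_assoc]⟩

end Formulas
end FirstOrder.Language

/-! ### Groups of uniform width are absolutely connected -/

open FirstOrder.Language FirstOrder.Language.Structure

section Saturation

variable {L : FirstOrder.Language.{u, v}} {M : Type w} [L.Structure M] {κ : Cardinal.{w}}

lemma IsSaturatedModel.exists_realize (hM : IsSaturatedModel L M κ) {Y : Type w} (hY : #Y < κ)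
    (y : Y → M) {ι : Type*} (p : ι → L.Formula (Y ⊕ Unit))
    (hp : ∀ t : Finset ι, ∃ a : M, ∀ i ∈ t, (p i).Realize (Sum.elim y fun _ => a)) :
    ∃ a : M, ∀ i, (p i).Realize (Sum.elim y fun _ => a) := by
  classical
  have key : ∀ i (a : M), ((p i).relabel (Sum.map (Set.rangeFactorization y) id)).Realize
      (Sum.elim (fun b : Set.range y => (b : M)) fun _ => a) ↔
        (p i).Realize (Sum.elim y fun _ => a) := by
    intro i a
    rw [Formula.realize_relabel, Sum.elim_comp_map]
    rfl
  obtain ⟨a, ha⟩ := hM (Set.range y) (mk_range_le.trans_lt hY)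
    (Set.range fun i => (p i).relabel (Sum.map (Set.rangeFactorization y) id)) (by
      intro s hs hfin
      choose f hf using hs
      have := hfin.fintype
      obtain ⟨a, ha⟩ := hp (Finset.univ.image fun φ : s => f φ.2)
      refine ⟨a, fun φ hφ => ?_⟩
      rw [← hf hφ, key]
      exact ha _ (Finset.mem_image_of_mem (fun φ : s => f φ.2) (Finset.mem_univ ⟨φ, hφ⟩)))
  exact ⟨a, fun i => (key i a).1 (ha _ ⟨i, rfl⟩)⟩

lemma IsStronglyHomogeneous.exists_equiv (hM : IsStronglyHomogeneous L M κ) {Z : Type w}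
    (hZ : #Z < κ) (x x' : Z → M) (h : ∀ φ : L.Formula Z, φ.Realize x ↔ φ.Realize x') :
    ∃ σ : M ≃[L] M, ∀ z, σ (x z) = x' z := by
  let r : Set.range x → Z := fun b => b.2.choose
  have hr : ∀ b, x (r b) = b := fun b => b.2.choose_spec
  obtain ⟨σ, hσ⟩ := hM (Set.range x) (x' ∘ r) (mk_range_le.trans_lt hZ) fun φ => by
    have := h (φ.relabel r)
    rw [Formula.realize_relabel, Formula.realize_relabel] at this
    rwa [show x ∘ r = fun b : Set.range x => (b : M) from funext hr] at this
  refine ⟨σ, fun z => ?_⟩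
  have h1 := hσ ⟨x z, z, rfl⟩
  have h2 := (h ((Term.var (r ⟨x z, z, rfl⟩)).equal (Term.var z))).1
    (Formula.realize_equal.2 (hr _))
  exact h1.trans (Formula.realize_equal.1 h2)

variable [Group M]

/-- In a saturated model, whether `d` is the quotient of a pair with the same type can be tested
on finite sets of formulas. -/
lemma IsSaturatedModel.mem_quotientSet_univ (hM : IsSaturatedModel L M κ) (hκ : ℵ₀ ≤ κ)
    {m : L.Functions 2} (hm : ∀ a b : M, funMap m ![a, b] = a * b) {Y : Type w} (hY : #Y < κ)
    (y : Y → M) {d : M}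
    (hd : ∀ s : Set (L.Formula (Y ⊕ Unit)), s.Finite → d ∈ quotientSet (SameType s y)) :
    d ∈ quotientSet (SameType (L := L) Set.univ y) := by
  -- `p φ` says of `a` that `φ` holds at `a` if and only if it holds at `a * d`
  let p : L.Formula (Y ⊕ Unit) → L.Formula ((Y ⊕ Unit) ⊕ Unit) := fun φ =>
    Formula.iff
      (BoundedFormula.subst φ (Sum.elim (fun z => Term.var (Sum.inl (Sum.inl z)))
        fun _ => Term.var (Sum.inr ())))
      (BoundedFormula.subst φ (Sum.elim (fun z => Term.var (Sum.inl (Sum.inl z)))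
        fun _ => m.apply₂ (Term.var (Sum.inr ())) (Term.var (Sum.inl (Sum.inr ())))))
  have key : ∀ (φ : L.Formula (Y ⊕ Unit)) (a : M),
      (p φ).Realize (Sum.elim (Sum.elim y fun _ => d) fun _ => a) ↔
      (φ.Realize (Sum.elim y fun _ => a) ↔ φ.Realize (Sum.elim y fun _ => a * d)) := by
    intro φ a
    rw [Formula.realize_iff]
    simp only [Formula.Realize, BoundedFormula.realize_subst]
    refine iff_congr (iff_of_eq ?_) (iff_of_eq ?_)
    · congr 1
      ext (_ | _) <;> rfl
    · congr 1
      ext (_ | _)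
      · rfl
      · simp [hm]
  obtain ⟨a, ha⟩ := hM.exists_realize (Y := Y ⊕ Unit)
    (by simpa using add_lt_of_lt hκ hY (one_lt_aleph0.trans_le hκ))
    (Sum.elim y fun _ => d) p fun t => by
      obtain ⟨a, _, hr, rfl⟩ := hd t t.finite_toSet
      exact ⟨a, fun φ hφ => (key φ a).2 (hr φ hφ)⟩
  exact ⟨a, a * d, fun φ _ => (key φ a).1 (ha φ), rfl⟩

/-- In a saturated model, membership in the `n`-th power of a quotient set can be tested on
finite sets of formulas. -/
lemma IsSaturatedModel.mem_quotientSet_univ_pow (hM : IsSaturatedModel L M κ) (hκ : ℵ₀ ≤ κ)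
    {m : L.Functions 2} (hm : ∀ a b : M, funMap m ![a, b] = a * b) {Y : Type w} (hY : #Y < κ)
    (y : Y → M) (n : ℕ) {g : M}
    (hg : ∀ s : Set (L.Formula (Y ⊕ Unit)), s.Finite → g ∈ quotientSet (SameType s y) ^ n) :
    g ∈ quotientSet (SameType (L := L) Set.univ y) ^ n := by
  induction n generalizing g with
  | zero => simpa using hg ∅ Set.finite_empty
  | succ n ih =>
    -- `p s` says of `d` that it is a first factor of `g`, with respect to the finite set `s`
    let p : {s : Set (L.Formula (Y ⊕ Unit)) // s.Finite} → L.Formula ((Y ⊕ Unit) ⊕ Unit) :=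
      fun s =>
        haveI := s.2.to_subtype
        (((powFormula m s.1 1).relabel
          (Sum.elim (fun z => Sum.inl (Sum.inl (Sum.inl z))) fun _ => Sum.inl (Sum.inr ()) :
            Y ⊕ Unit → ((Y ⊕ Unit) ⊕ Unit) ⊕ Unit)) ⊓
        (((powFormula m s.1 n).relabel
          (Sum.elim (fun z => Sum.inl (Sum.inl (Sum.inl z))) fun _ => Sum.inr ())) ⊓
        ((m.apply₂ (Term.var (Sum.inl (Sum.inr ()))) (Term.var (Sum.inr ()))).equal
          (Term.var (Sum.inl (Sum.inl (Sum.inr ()))))))).iExs Unit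
    have key : ∀ s d, (p s).Realize (Sum.elim (Sum.elim y fun _ => g) fun _ => d) ↔
        ∃ z, d ∈ quotientSet (SameType s.1 y) ∧ z ∈ quotientSet (SameType s.1 y) ^ n ∧
          d * z = g := by
      intro s d
      have := s.2.to_subtype
      have h0 : ∀ i : Unit → M, (Sum.elim (Sum.elim (Sum.elim y fun _ => g) fun _ => d) i) ∘
          (Sum.elim (fun z => Sum.inl (Sum.inl (Sum.inl z))) fun _ => Sum.inl (Sum.inr ()) :
            Y ⊕ Unit → ((Y ⊕ Unit) ⊕ Unit) ⊕ Unit) = Sum.elim y fun _ => d := fun i => by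
        ext (_ | _) <;> rfl
      have h1 : ∀ i : Unit → M, (Sum.elim (Sum.elim (Sum.elim y fun _ => g) fun _ => d) i) ∘
          (Sum.elim (fun z => Sum.inl (Sum.inl (Sum.inl z))) fun _ => Sum.inr () :
            Y ⊕ Unit → ((Y ⊕ Unit) ⊕ Unit) ⊕ Unit) = Sum.elim y fun _ => i () := fun i => by
        ext (_ | _) <;> rfl
      simp only [p, Formula.realize_iExs, Formula.realize_inf, Formula.realize_relabel,
        h0, h1, realize_powFormula hm, Formula.realize_equal, Term.realize_functions_apply₂,
        Term.realize_var, Sum.elim_inr, Sum.elim_inl, hm, pow_one]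
      exact ⟨fun ⟨i, hi⟩ => ⟨i (), hi⟩, fun ⟨z, hz⟩ => ⟨fun _ => z, hz⟩⟩
    obtain ⟨d, hd⟩ := hM.exists_realize (Y := Y ⊕ Unit)
      (by simpa using add_lt_of_lt hκ hY (one_lt_aleph0.trans_le hκ))
      (Sum.elim y fun _ => g) p fun t => by
        have hfin : (⋃ s ∈ t, s.1 : Set (L.Formula (Y ⊕ Unit))).Finite :=
          t.finite_toSet.biUnion fun s _ => s.2
        have hgt := hg _ hfin
        rw [pow_succ', Set.mem_mul] at hgt
        obtain ⟨d, hd, z, hz, hdz⟩ := hgt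
        refine ⟨d, fun s hs => (key s d).2 ⟨z, ?_, ?_, hdz⟩⟩
        · exact quotientSet_mono
            (fun a b hr φ hφ => hr φ (Set.mem_biUnion (x := s) hs hφ)) hd
        · exact quotientSet_pow_mono
            (fun a b hr φ hφ => hr φ (Set.mem_biUnion (x := s) hs hφ)) n hz
    have h1 : d ∈ quotientSet (SameType (L := L) Set.univ y) :=
      hM.mem_quotientSet_univ hκ hm hY y fun s hs => by
        obtain ⟨z, hz, -⟩ := (key ⟨s, hs⟩ d).1 (hd ⟨s, hs⟩)
        exact hz
    have h2 : d⁻¹ * g ∈ quotientSet (SameType (L := L) Set.univ y) ^ n := ih fun s hs => by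
      obtain ⟨z, -, hz, hdz⟩ := (key ⟨s, hs⟩ d).1 (hd ⟨s, hs⟩)
      rwa [← hdz, inv_mul_cancel_left]
    rw [pow_succ']
    have := Set.mul_mem_mul h1 h2
    rwa [mul_inv_cancel_left] at this

end Saturation

/-- An automorphism of a monster model is multiplicative. -/
lemma MonsterModel.map_mul {G : Type u} [Group G] {E : GroupExpansion G} (M : MonsterModel E)
    (σ : M.carrier ≃[E.L] M.carrier) (a b : M.carrier) : σ (a * b) = σ a * σ b := by
  rw [← M.funMap_mul, ← M.funMap_mul, σ.map_fun]
  congr 1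
  ext i
  fin_cases i <;> rfl

lemma MonsterModel.map_inv {G : Type u} [Group G] {E : GroupExpansion G} (M : MonsterModel E)
    (σ : M.carrier ≃[E.L] M.carrier) (a : M.carrier) : σ a⁻¹ = (σ a)⁻¹ :=
  _root_.map_inv (MonoidHom.mk' σ (M.map_mul σ)) a

/-- If `K` is an invariant subgroup of bounded index, then two elements with the same type over
the parameters and representatives of all cosets are conjugate under an automorphism that fixes
each coset of `K`, hence lie in the same coset. -/
theorem HasUniformWidth.isAbsolutelyConnected {Γ : Type u} [Group Γ] [Infinite Γ]
    (h : HasUniformWidth Γ) : IsAbsolutelyConnected Γ := by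
  refine ⟨inferInstance, fun E => ⟨inferInstance, fun M B hB => ⟨⟨?_, fun _ _ _ _ => trivial⟩, ?_⟩⟩⟩
  · refine lt_of_le_of_lt ?_ (one_lt_aleph0.trans M.aleph0_lt)
    have : Subsingleton (M.carrier ⧸ (⊤ : Subgroup M.carrier)) :=
      QuotientGroup.subsingleton_quotient_top
    exact Cardinal.le_one_iff_subsingleton.2 this
  rintro K ⟨hindex, hinv⟩
  have hκ := M.aleph0_lt.le
  let y : B ⊕ (M.carrier ⧸ K) → M.carrier := Sum.elim (fun b => b) Quotient.out
  have hY : #(B ⊕ (M.carrier ⧸ K)) < M.κ := by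
    simpa using add_lt_of_lt hκ hB hindex
  have hK : quotientSet (SameType (L := E.L) Set.univ y) ⊆ K := by
    rintro x ⟨a, b, hab, hx⟩
    obtain ⟨σ, hσ⟩ := M.isStronglyHomogeneous.exists_equiv
      (Z := (B ⊕ (M.carrier ⧸ K)) ⊕ Unit)
      (by simpa using add_lt_of_lt hκ hY (one_lt_aleph0.trans_le hκ))
      (Sum.elim y fun _ => a) (Sum.elim y fun _ => b) fun φ => hab φ trivial
    let r : M.carrier := Quotient.out (QuotientGroup.mk (s := K) a)
    have hr : r⁻¹ * a ∈ K := QuotientGroup.eq.1 (QuotientGroup.out_eq' _)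
    have hσr : σ r = r := hσ (Sum.inl (Sum.inr (QuotientGroup.mk a)))
    have hσa : σ a = b := hσ (Sum.inr ())
    have hrb := hinv σ (fun z hz => hσ (Sum.inl (Sum.inl ⟨z, hz⟩))) _ hr
    rw [M.map_mul, M.map_inv, hσr, hσa] at hrb
    have := K.mul_mem (K.inv_mem hr) hrb
    rw [eq_inv_mul_of_mul_eq hx]
    rwa [mul_inv_rev, inv_inv, mul_assoc, mul_inv_cancel_left] at this
  obtain ⟨N, hN⟩ := h
  intro g _
  have hpow : ∀ n, quotientSet (SameType (L := E.L) Set.univ y) ^ n ⊆ (K : Set M.carrier) := by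
    intro n
    induction n with
    | zero => simp
    | succ n ih =>
      rw [pow_succ]
      rintro _ ⟨a, ha, b, hb, rfl⟩
      exact K.mul_mem (ih ha) (hK hb)
  refine hpow N (M.isSaturated.mem_quotientSet_univ_pow hκ M.funMap_mul hY y N fun s hs => ?_)
  -- an element and parameters violating the width for `s` would also exist in `Γ`
  have := hs.to_subtype
  rw [← realize_powFormula M.funMap_mul]
  by_contra hcon
  obtain ⟨v, hv⟩ := M.embedding.exists_realize (∼(powFormula E.mul s N)) hcon
  refine hv ?_
  rw [← Sum.elim_comp_inl_inr v]
  refine (realize_powFormula E.funMap_mul s _ N (v (Sum.inr ()))).2 ?_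
  have hmem := hN ((fun φ : E.L.Formula _ =>
    {x : Γ | φ.Realize (Sum.elim (v ∘ Sum.inl) fun _ => x)}) '' s) (hs.image _) ▸
    Set.mem_univ (v (Sum.inr ()))
  refine quotientSet_pow_mono (fun a b hr φ hφ => ?_) N hmem
  exact hr _ (Set.mem_image_of_mem _ hφ)

/-! ### Chains of realizations -/

section Chain

variable (L : FirstOrder.Language.{u, u}) (G : Type u) (J : Type u) [LinearOrder J]
  [WellFoundedLT J]

/-- The new variables of stage `j`: one copy of the set of variables of the earlier stages for
every set of formulas that relates such a copy to the earlier variables. -/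
noncomputable def NewVar : J → Type u :=
  WellFounded.fix (wellFounded_lt (α := J)) fun j P =>
    Set (L.Formula ((G ⊕ Σ k : Set.Iio j, P k k.2) ⊕ (G ⊕ Σ k : Set.Iio j, P k k.2))) ×
      (G ⊕ Σ k : Set.Iio j, P k k.2)

/-- The variables available at stage `j`: names for the elements of `G` and the new variables of
the earlier stages. -/
abbrev OldVar (j : J) : Type u := G ⊕ Σ k : Set.Iio j, NewVar L G J k

lemma newVar_eq (j : J) :
    NewVar L G J j =
      (Set (L.Formula (OldVar L G J j ⊕ OldVar L G J j)) × OldVar L G J j) :=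
  WellFounded.fix_eq _ _ j

/-- A valuation of all new variables in `G`. -/
abbrev VarValuation : Type u := (Σ j, NewVar L G J j) → G

variable {L G J}

/-- The inclusion of the variables of stage `j` into all variables. -/
def OldVar.incl (j : J) : OldVar L G J j → G ⊕ Σ j, NewVar L G J j :=
  Sum.map id fun p => ⟨p.1, p.2⟩

/-- The copy of the variable `x` introduced at stage `j` for the set of formulas `Q`. -/
noncomputable def newVar (j : J) (Q : Set (L.Formula (OldVar L G J j ⊕ OldVar L G J j)))
    (x : OldVar L G J j) : G ⊕ Σ j, NewVar L G J j :=
  Sum.inr ⟨j, cast (newVar_eq L G J j).symm (Q, x)⟩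

/-- The valuation of all variables that extends a valuation of the new variables; names are
interpreted by the elements they name. -/
def VarValuation.eval (v : VarValuation L G J) : (G ⊕ Σ j, NewVar L G J j) → G := Sum.elim id v

/-- A set of valuations determined by the values of the variables of stage `j`. -/
def IsDetermined (j : J) (Z : Set (VarValuation L G J)) : Prop :=
  ∀ v v' : VarValuation L G J, v.eval ∘ OldVar.incl j = v'.eval ∘ OldVar.incl j → v ∈ Z → v' ∈ Z

lemma IsDetermined.compl {j : J} {Z : Set (VarValuation L G J)} (h : IsDetermined j Z) :
    IsDetermined j Zᶜ := fun v v' hv hvZ hv' => hvZ (h v' v hv.symm hv')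

lemma eval_eq_of_lt {j k : J} (hk : k < j) {v v' : VarValuation L G J}
    (h : v.eval ∘ OldVar.incl j = v'.eval ∘ OldVar.incl j) (p : NewVar L G J k) :
    v ⟨k, p⟩ = v' ⟨k, p⟩ :=
  congrFun h (Sum.inr ⟨⟨k, hk⟩, p⟩)

lemma eval_incl_eq_of_le {j k : J} (hk : k ≤ j) {v v' : VarValuation L G J}
    (h : v.eval ∘ OldVar.incl j = v'.eval ∘ OldVar.incl j) :
    v.eval ∘ OldVar.incl k = v'.eval ∘ OldVar.incl k := by
  ext (g | ⟨⟨i, hi⟩, p⟩)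
  · rfl
  · exact eval_eq_of_lt (lt_of_lt_of_le hi hk) h p

variable [L.Structure G]

/-- The set of formulas `Q` is finitely satisfiable over the variables of stage `j`, for almost
all valuations. -/
def IsConsistentAt (j : J) (U : Ultrafilter (VarValuation L G J))
    (Q : Set (L.Formula (OldVar L G J j ⊕ OldVar L G J j))) : Prop :=
  ∀ s ⊆ Q, s.Finite → ∀ᶠ v in (U : Filter (VarValuation L G J)), ∃ w : OldVar L G J j → G,
    ∀ φ ∈ s, φ.Realize (Sum.elim (v.eval ∘ OldVar.incl j) w)

/-- The requirements of stage `j`: keep what `U` says about the variables of stage `j`, and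
realize each consistent set of formulas by the new variables introduced for it. -/
def requirements (j : J) (U : Ultrafilter (VarValuation L G J)) : Set (Set (VarValuation L G J)) :=
  {Z | Z ∈ U ∧ IsDetermined j Z} ∪
    {Z | ∃ Q, IsConsistentAt j U Q ∧ ∃ φ ∈ Q,
      Z = {v | φ.Realize (Sum.elim (v.eval ∘ OldVar.incl j) (v.eval ∘ newVar j Q))}}

lemma isDetermined_of_mem_requirements {j k : J} (hk : k < j)
    {U : Ultrafilter (VarValuation L G J)} {Z : Set (VarValuation L G J)}
    (hZ : Z ∈ requirements k U) : IsDetermined j Z := by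
  intro v v' h hv
  rcases hZ with ⟨-, hZ⟩ | ⟨Q, -, φ, -, rfl⟩
  · exact hZ v v' (eval_incl_eq_of_le hk.le h) hv
  · have h1 : v.eval ∘ newVar k Q = v'.eval ∘ newVar k Q := funext fun x =>
      eval_eq_of_lt hk h _
    rwa [Set.mem_ofPred_eq, eval_incl_eq_of_le hk.le h, h1] at hv

variable [Nonempty G]

/-- Finitely many requirements of one stage are satisfied by changing a valuation on the new
variables of this stage only. -/
lemma generate_requirements_neBot (j : J) (U : Ultrafilter (VarValuation L G J)) :
    (Filter.generate (requirements j U)).NeBot := by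
  classical
  rw [Filter.generate_neBot_iff]
  intro t ht hfin
  let IsNew : Set (VarValuation L G J) → Prop := fun Z => ∃ Q, IsConsistentAt j U Q ∧ ∃ φ ∈ Q,
      Z = {v | φ.Realize (Sum.elim (v.eval ∘ OldVar.incl j) (v.eval ∘ newVar j Q))}
  have hnew : ∀ Z : {Z // Z ∈ t ∧ IsNew Z}, IsNew Z.1 := fun Z => Z.2.2
  choose Q hQ φ hφQ hZ using hnew
  have hfin' : Finite {Z // Z ∈ t ∧ IsNew Z} := (hfin.subset fun Z hZ => hZ.1).to_subtype
  let s : Set (L.Formula (OldVar L G J j ⊕ OldVar L G J j)) → Set (L.Formula _) :=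
    fun q => φ '' {Z | Q Z = q}
  have hev : ∀ᶠ v in (U : Filter (VarValuation L G J)), ∀ Z : {Z // Z ∈ t ∧ IsNew Z},
      ∃ w : OldVar L G J j → G, ∀ ψ ∈ s (Q Z),
        ψ.Realize (Sum.elim (v.eval ∘ OldVar.incl j) w) := by
    refine Filter.eventually_all.2 fun Z => hQ Z _ ?_ ((Set.toFinite _).image _)
    rintro _ ⟨Z', hZ', rfl⟩
    exact hZ' ▸ hφQ Z'
  have hev' : ∀ᶠ v in (U : Filter (VarValuation L G J)), ∀ Z ∈ t, Z ∈ U → v ∈ Z :=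
    (Filter.eventually_all_finite hfin).2 fun Z _ => by
      by_cases h : Z ∈ U
      · exact Filter.mem_of_superset h fun v hv _ => hv
      · exact Filter.Eventually.of_forall fun v hv => absurd hv h
  obtain ⟨v, hv, hv'⟩ := (hev.and hev').exists
  let w : Set (L.Formula (OldVar L G J j ⊕ OldVar L G J j)) → OldVar L G J j → G := fun q =>
    if h : ∃ w : OldVar L G J j → G, ∀ ψ ∈ s q,
        ψ.Realize (Sum.elim (v.eval ∘ OldVar.incl j) w) then h.choose
    else fun _ => Classical.arbitrary G
  have hw : ∀ Z, ∀ ψ ∈ s (Q Z), ψ.Realize (Sum.elim (v.eval ∘ OldVar.incl j) (w (Q Z))) := by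
    intro Z
    simp only [w, dif_pos (hv Z)]
    exact (hv Z).choose_spec
  let v' : VarValuation L G J := fun p =>
    if h : p.1 = j then
      let q := cast (newVar_eq L G J j) (h ▸ p.2)
      w q.1 q.2
    else v p
  have hold : v'.eval ∘ OldVar.incl j = v.eval ∘ OldVar.incl j := by
    ext (g | ⟨⟨k, hk⟩, p⟩)
    · rfl
    · exact dif_neg (ne_of_lt hk)
  have hnewVar : ∀ q, v'.eval ∘ newVar j q = w q := by
    intro q
    ext x
    change v' ⟨j, _⟩ = _
    simp [v']
  refine ⟨v', fun Z hZt => ?_⟩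
  by_cases h : IsNew Z
  · have h1 := hw ⟨Z, hZt, h⟩ _ ⟨⟨Z, hZt, h⟩, rfl, rfl⟩
    have h2 : v' ∈ ((⟨Z, hZt, h⟩ : {Z // Z ∈ t ∧ IsNew Z}) : Set (VarValuation L G J)) := by
      rw [hZ, Set.mem_ofPred_eq, hold, hnewVar]
      exact h1
    exact h2
  · rcases ht hZt with ⟨hZU, hdet⟩ | h'
    · exact hdet v v' hold.symm (hv' Z hZt hZU)
    · exact absurd h' h

/-- An ultrafilter finer than the given filter, if that filter is not trivial. -/
noncomputable def Ultrafilter.finer {X : Type*} [Nonempty X] (F : Filter X) : Ultrafilter X :=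
  open Classical in
  if h : F.NeBot then @Ultrafilter.of _ F h else pure (Classical.arbitrary X)

lemma Ultrafilter.finer_le {X : Type*} [Nonempty X] {F : Filter X} (h : F.NeBot) :
    (Ultrafilter.finer F : Filter X) ≤ F := by
  rw [Ultrafilter.finer, dif_pos h]
  exact Ultrafilter.of_le F

variable (L G J) in
/-- The ultrafilter of stage `j` satisfies the requirements of all earlier stages. -/
noncomputable def stage : J → Ultrafilter (VarValuation L G J) :=
  WellFounded.fix (wellFounded_lt (α := J)) fun j U =>
    Ultrafilter.finer (⨅ k : Set.Iio j, Filter.generate (requirements k.1 (U k k.2)))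

lemma stage_eq (j : J) :
    stage L G J j =
      Ultrafilter.finer (⨅ k : Set.Iio j, Filter.generate (requirements k.1 (stage L G J k))) :=
  WellFounded.fix_eq _ _ j

lemma generate_requirements_le {j k : J} (hk : k < j)
    (h : (stage L G J j : Filter (VarValuation L G J)) ≤
      Filter.generate (requirements k (stage L G J k))) :
    Filter.generate (requirements j (stage L G J j)) ≤
      Filter.generate (requirements k (stage L G J k)) := by
  rw [Filter.le_generate_iff]
  intro Z hZ
  refine Filter.mem_generate_of_mem (Or.inl ⟨?_, isDetermined_of_mem_requirements hk hZ⟩)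
  exact h (Filter.mem_generate_of_mem hZ)

lemma stage_le (j : J) : ∀ k < j, (stage L G J j : Filter (VarValuation L G J)) ≤
    Filter.generate (requirements k (stage L G J k)) := by
  induction j using WellFoundedLT.induction with
  | ind j ih =>
    intro k hk
    have : Nonempty (Set.Iio j) := ⟨⟨k, hk⟩⟩
    have hanti : Antitone fun k : Set.Iio j =>
        Filter.generate (requirements k.1 (stage L G J k)) := by
      intro a b hab
      rcases hab.eq_or_lt with rfl | hlt
      · exact le_rfl
      · exact generate_requirements_le hlt (ih b b.2 a hlt)
    rw [stage_eq]
    refine (Ultrafilter.finer_le ?_).trans (iInf_le _ (⟨k, hk⟩ : Set.Iio j))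
    exact Filter.iInf_neBot_of_directed' hanti.directed_ge fun i =>
      generate_requirements_neBot _ _

variable (L G J) in
/-- An ultrafilter that satisfies the requirements of all stages. -/
noncomputable def finalStage : Ultrafilter (VarValuation L G J) :=
  Ultrafilter.finer (⨅ k : J, Filter.generate (requirements k (stage L G J k)))

lemma finalStage_le (j : J) : (finalStage L G J : Filter (VarValuation L G J)) ≤
    Filter.generate (requirements j (stage L G J j)) := by
  have : Nonempty J := ⟨j⟩
  have hanti : Antitone fun k : J => Filter.generate (requirements k (stage L G J k)) := by
    intro a b hab
    rcases hab.eq_or_lt with rfl | hlt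
    · exact le_rfl
    · exact generate_requirements_le hlt (stage_le b a hlt)
  refine (Ultrafilter.finer_le ?_).trans (iInf_le _ j)
  exact Filter.iInf_neBot_of_directed' hanti.directed_ge fun i =>
    generate_requirements_neBot _ _

variable (L G J) in
/-- The ultrapower of `G` over the valuations. -/
abbrev ValuationPower : Type u :=
  (finalStage L G J : Filter (VarValuation L G J)).Product fun _ => G

/-- The element of the ultrapower denoted by a variable. -/
noncomputable def varValue (x : G ⊕ Σ j, NewVar L G J j) : ValuationPower L G J :=
  ((fun v : VarValuation L G J => v.eval x : VarValuation L G J → G) : ValuationPower L G J)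

lemma realize_varValue {α : Type*} (φ : L.Formula α) (t : α → G ⊕ Σ j, NewVar L G J j) :
    φ.Realize (varValue ∘ t) ↔
      ∀ᶠ v in (finalStage L G J : Filter (VarValuation L G J)), φ.Realize (v.eval ∘ t) :=
  Ultraproduct.realize_formula_cast (u := finalStage L G J) (M := fun _ => G) φ
    fun i (v : VarValuation L G J) => v.eval (t i)

/-- A set of formulas that is finitely satisfiable in the ultrapower over the elements denoted
by the variables of stage `j` was consistent at stage `j`, hence is realized by new variables. -/
lemma realize_newVar (j : J) (Q : Set (L.Formula (OldVar L G J j ⊕ OldVar L G J j)))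
    (hQ : ∀ s ⊆ Q, s.Finite → ∃ w : OldVar L G J j → ValuationPower L G J,
      ∀ φ ∈ s, φ.Realize (Sum.elim (varValue ∘ OldVar.incl j) w)) :
    ∀ φ ∈ Q, φ.Realize (Sum.elim (varValue ∘ OldVar.incl j) (varValue ∘ newVar j Q)) := by
  have hcons : IsConsistentAt j (stage L G J j) Q := by
    intro s hs hfin
    obtain ⟨w, hw⟩ := hQ s hs hfin
    have hrep : ∀ x, ∃ w' : VarValuation L G J → G, (w' : ValuationPower L G J) = w x :=
      fun x => Quotient.exists_rep (w x)
    choose w' hw' using hrep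
    have hfinal : ∀ᶠ v in (finalStage L G J : Filter (VarValuation L G J)),
        ∃ w : OldVar L G J j → G, ∀ φ ∈ s,
          φ.Realize (Sum.elim (v.eval ∘ OldVar.incl j) w) := by
      have : ∀ᶠ v in (finalStage L G J : Filter (VarValuation L G J)), ∀ φ ∈ s,
          φ.Realize (Sum.elim (v.eval ∘ OldVar.incl j) fun x => w' x v) := by
        refine (Filter.eventually_all_finite hfin).2 fun φ hφ => ?_
        have h1 := hw φ hφ
        have h2 := (Ultraproduct.realize_formula_cast (u := finalStage L G J)
          (M := fun _ => G) φ
          (Sum.elim (fun x v => v.eval (OldVar.incl j x)) w')).1 (by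
            rw [← funext hw'] at h1
            refine Eq.mp (congrArg (fun z : _ → ValuationPower L G J => φ.Realize z)
              (funext fun x => ?_)) h1
            cases x <;> rfl)
        filter_upwards [h2] with v hv
        convert hv using 1
        ext (x | x) <;> rfl
      exact this.mono fun v hv => ⟨_, hv⟩
    by_contra hcon
    have hmem : {v : VarValuation L G J | ∃ w : OldVar L G J j → G, ∀ φ ∈ s,
        φ.Realize (Sum.elim (v.eval ∘ OldVar.incl j) w)}ᶜ ∈
          requirements j (stage L G J j) := by
      refine Or.inl ⟨Ultrafilter.compl_mem_iff_notMem.2 hcon, IsDetermined.compl ?_⟩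
      rintro v v' h ⟨w, hw⟩
      exact ⟨w, by rwa [← h]⟩
    have h1 := finalStage_le j (Filter.mem_generate_of_mem hmem)
    exact Ultrafilter.compl_mem_iff_notMem.1 h1 hfinal
  intro φ hφ
  rw [← Sum.comp_elim, realize_varValue]
  have h1 := finalStage_le j (Filter.mem_generate_of_mem (Or.inr ⟨Q, hcons, φ, hφ, rfl⟩))
  filter_upwards [h1] with v hv
  rwa [Sum.comp_elim]

end Chain

/-- A family of maps `e j : X j → M` with increasing ranges such that every set of formulas which
is finitely satisfiable over the range of `e j` is realized in the range of `e k`, for `j < k`.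
The sets of formulas describe families of elements indexed by `X j`. -/
structure IsRealizingChain (L : FirstOrder.Language.{u, u}) {M J : Type u} [L.Structure M]
    [LinearOrder J] {X : J → Type u} (e : ∀ j, X j → M) : Prop where
  nonempty : ∀ j, Nonempty (X j)
  range_mono : ∀ j k, j ≤ k → Set.range (e j) ⊆ Set.range (e k)
  exists_realize : ∀ j k, j < k → ∀ Q : Set (L.Formula (X j ⊕ X j)),
    (∀ s ⊆ Q, s.Finite → ∃ w : X j → M, ∀ φ ∈ s, φ.Realize (Sum.elim (e j) w)) →
      ∃ w : X j → X k, ∀ φ ∈ Q, φ.Realize (Sum.elim (e j) (e k ∘ w))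

lemma exists_elementaryEmbedding_isRealizingChain (L : FirstOrder.Language.{u, u}) (G J : Type u)
    [L.Structure G] [Nonempty G] [LinearOrder J] [WellFoundedLT J] :
    ∃ (N : Type u) (_ : L.Structure N) (f : G ↪ₑ[L] N) (X : J → Type u) (e : ∀ j, X j → N),
      IsRealizingChain L e ∧ ∀ j, Set.range f ⊆ Set.range (e j) := by
  refine ⟨ValuationPower L G J, inferInstance, ⟨fun g => varValue (Sum.inl g), ?_⟩,
    OldVar L G J, fun j => varValue ∘ OldVar.incl j, ⟨fun j => ?_, ?_, fun j k hjk Q hQ => ?_⟩, ?_⟩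
  · intro n φ x
    refine (realize_varValue φ fun i => Sum.inl (x i)).trans ?_
    exact Filter.eventually_const (f := (finalStage L G J : Filter (VarValuation L G J)))
      (p := φ.Realize x)
  · exact ‹Nonempty G›.map Sum.inl
  · rintro j k hjk _ ⟨g | ⟨⟨i, hi⟩, p⟩, rfl⟩
    · exact ⟨Sum.inl g, rfl⟩
    · exact ⟨Sum.inr ⟨⟨i, lt_of_lt_of_le hi hjk⟩, p⟩, rfl⟩
  · refine ⟨fun x => Sum.inr ⟨⟨j, hjk⟩, cast (newVar_eq L G J j).symm (Q, x)⟩, ?_⟩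
    exact realize_newVar j Q hQ
  · rintro j _ ⟨g, rfl⟩
    exact ⟨Sum.inl g, rfl⟩

/-- The union of a realizing chain is an elementary substructure. -/
lemma exists_elementaryEmbedding_isRealizingChain_covering (L : FirstOrder.Language.{u, u})
    (G J : Type u) [L.Structure G] [Nonempty G] [LinearOrder J] [WellFoundedLT J] [Nonempty J]
    [NoMaxOrder J] :
    ∃ (M : Type u) (_ : L.Structure M) (_ : G ↪ₑ[L] M) (X : J → Type u) (e : ∀ j, X j → M),
      IsRealizingChain L e ∧ ∀ a, ∃ j, a ∈ Set.range (e j) := by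
  classical
  obtain ⟨N, _, f, X, e, he, hf⟩ := exists_elementaryEmbedding_isRealizingChain L G J
  let A : Set N := ⋃ j, Set.range (e j)
  have hA : L.MeetsDefinable A := by
    intro D hD hdef
    obtain ⟨A₀, hA₀, hdef⟩ := Set.definable_iff_finitely_definable.1 hdef
    obtain ⟨φ, hφ⟩ := Set.definable_iff_exists_formula_sum.1 hdef
    have hex : ∀ a : A₀, ∃ j, (a : N) ∈ Set.range (e j) := fun a =>
      Set.mem_iUnion.1 (hA₀ a.2)
    choose i hi using hex
    obtain ⟨j, hj⟩ := Finite.exists_le i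
    choose r hr using fun a : A₀ => he.range_mono _ _ (hj a) (hi a)
    obtain ⟨k, hk⟩ := exists_gt j
    obtain ⟨x₀⟩ := he.nonempty j
    obtain ⟨d, hd⟩ := hD
    have key : ∀ w : X j → N, (φ.relabel (Sum.map r fun _ => x₀)).Realize (Sum.elim (e j) w) ↔
        w x₀ ∈ D := by
      intro w
      have h1 : (fun _ : Fin 1 => w x₀) ∈ {v : Fin 1 → N | v 0 ∈ D} ↔ w x₀ ∈ D := Iff.rfl
      rw [← h1, hφ, Formula.realize_relabel, Sum.elim_comp_map, Set.mem_ofPred_eq]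
      rw [show e j ∘ r = fun a : A₀ => (a : N) from funext hr]
      rfl
    obtain ⟨w, hw⟩ := he.exists_realize j k hk {φ.relabel (Sum.map r fun _ => x₀)} fun s hs _ =>
      ⟨fun _ => d, fun ψ hψ => by rw [hs hψ, key]; exact hd⟩
    exact ⟨_, (key _).1 (hw _ rfl), Set.mem_iUnion.2 ⟨k, ⟨_, rfl⟩⟩⟩
  let S := hA.toElementarySubstructure
  have hS : ∀ a, a ∈ S ↔ a ∈ A := fun a => by
    change a ∈ (Substructure.closure L A : Set N) ↔ _
    rw [hA.closure_eq_self]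
  have hval : ∀ {α : Type u} (φ : L.Formula α) (v : α → S),
      φ.Realize (fun i => (v i : N)) ↔ φ.Realize v := fun φ v => S.subtype.map_formula φ v
  refine ⟨S, inferInstance, ⟨fun g => ⟨f g, (hS _).2 ?_⟩, ?_⟩, X,
    fun j x => ⟨e j x, (hS _).2 (Set.mem_iUnion.2 ⟨j, x, rfl⟩)⟩, ⟨he.nonempty, ?_, ?_⟩, ?_⟩
  · exact Set.mem_iUnion.2 ⟨Classical.arbitrary J, hf _ ⟨g, rfl⟩⟩
  · intro n φ x
    rw [← S.subtype.map_formula]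
    exact f.map_formula φ x
  · rintro j k hjk _ ⟨x, rfl⟩
    obtain ⟨y, hy⟩ := he.range_mono j k hjk ⟨x, rfl⟩
    exact ⟨y, Subtype.ext hy⟩
  · intro j k hjk Q hQ
    obtain ⟨w, hw⟩ := he.exists_realize j k hjk Q fun s hs hfin => by
      obtain ⟨w, hw⟩ := hQ s hs hfin
      refine ⟨fun x => w x, fun φ hφ => ?_⟩
      convert (hval φ _).2 (hw φ hφ) using 1
      ext (x | x) <;> rfl
    refine ⟨w, fun φ hφ => (hval φ _).1 ?_⟩
    convert hw φ hφ using 1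
    ext (x | x) <;> rfl
  · rintro ⟨a, ha⟩
    obtain ⟨j, x, hx⟩ := Set.mem_iUnion.1 ((hS a).1 ha)
    exact ⟨j, x, Subtype.ext hx⟩

/-! ### Partial elementary relations -/

section ElementaryRelation

variable {L : FirstOrder.Language.{u, u}} {M : Type u} [L.Structure M]

variable (L) in
/-- A relation between elements of `M` is elementary if it relates only tuples with the same
type, that is, if it is the graph of a partial elementary map. -/
def IsElementaryRel (R : Set (M × M)) : Prop :=
  ∀ (n : ℕ) (φ : L.Formula (Fin n)) (t : Fin n → R),
    φ.Realize (fun i => (t i).1.1) ↔ φ.Realize (fun i => (t i).1.2)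

lemma IsElementaryRel.realize_iff {R : Set (M × M)} (hR : IsElementaryRel L R) {α : Type u}
    (φ : L.Formula α) (t : α → R) :
    φ.Realize (fun i => (t i).1.1) ↔ φ.Realize (fun i => (t i).1.2) := by
  obtain ⟨n, z, ψ, hψ⟩ := φ.exists_fin_realize_iff
  rw [← hψ, ← hψ]
  exact hR n ψ (t ∘ z)

lemma isElementaryRel_range {α : Type u} {a b : α → M}
    (h : ∀ φ : L.Formula α, φ.Realize a ↔ φ.Realize b) :
    IsElementaryRel L (Set.range fun i => (a i, b i)) := by
  intro n φ t
  choose z hz using fun i => (t i).2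
  have h1 := h (φ.relabel z)
  rw [Formula.realize_relabel, Formula.realize_relabel] at h1
  convert h1 using 2 <;> exact funext fun i => by simp [← hz]

lemma IsElementaryRel.swap {R : Set (M × M)} (hR : IsElementaryRel L R) :
    IsElementaryRel L (Prod.swap ⁻¹' R) := fun n φ t =>
  (hR n φ fun i => ⟨(t i).1.swap, (t i).2⟩).symm

lemma isElementaryRel_sUnion {C : Set (Set (M × M))} (hne : C.Nonempty) (hC : IsChain (· ⊆ ·) C)
    (h : ∀ R ∈ C, IsElementaryRel L R) : IsElementaryRel L (⋃₀ C) := by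
  intro n φ t
  obtain ⟨R, hR, hsub⟩ := DirectedOn.exists_mem_subset_of_finite_of_subset_sUnion hne
    hC.directedOn (Set.finite_range fun i => (t i).1) (by
      rintro _ ⟨i, rfl⟩
      exact (t i).2)
  exact h R hR n φ fun i => ⟨t i, hsub ⟨i, rfl⟩⟩

lemma IsElementaryRel.eq_iff {R : Set (M × M)} (hR : IsElementaryRel L R) {a b a' b' : M}
    (h : (a, b) ∈ R) (h' : (a', b') ∈ R) : a = a' ↔ b = b' := by
  have := hR 2 ((Term.var 0).equal (Term.var 1)) ![⟨_, h⟩, ⟨_, h'⟩]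
  simpa [Formula.realize_equal] using this

/-- An elementary relation with full domain and range is the graph of an automorphism. -/
lemma IsElementaryRel.exists_equiv {R : Set (M × M)} (hR : IsElementaryRel L R)
    (h1 : ∀ a, ∃ b, (a, b) ∈ R) (h2 : ∀ b, ∃ a, (a, b) ∈ R) :
    ∃ σ : M ≃[L] M, ∀ a, (a, σ a) ∈ R := by
  choose s hs using h1
  choose t ht using h2
  have hst : ∀ b, s (t b) = b := fun b => (hR.eq_iff (hs (t b)) (ht b)).1 rfl
  have hts : ∀ a, t (s a) = a := fun a => (hR.eq_iff (ht (s a)) (hs a)).2 rfl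
  refine ⟨⟨⟨s, t, hts, hst⟩, ?_, ?_⟩, hs⟩
  · intro n f x
    have := hR (n + 1) ((Term.func f fun i => Term.var i.castSucc).equal (Term.var (Fin.last n)))
      (Fin.snoc (fun i => ⟨_, hs (x i)⟩) ⟨_, hs (funMap f x)⟩)
    simp [Formula.realize_equal] at this
    exact this.symm
  · intro n r x
    have := hR n (r.formula Term.var) fun i => ⟨_, hs (x i)⟩
    simp [Formula.realize_rel] at this
    exact this.symm

variable {J : Type u} [LinearOrder J] {X : J → Type u} {e : ∀ j, X j → M}

/-- In a realizing chain, an elementary relation on one stage extends to an elementary relation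
whose domain contains the whole stage: the type of the stage over the domain is carried over to
the range and realized at a later stage. -/
lemma IsRealizingChain.exists_extend_left (he : IsRealizingChain L e) {R : Set (M × M)}
    (hR : IsElementaryRel L R) {j k : J} (hjk : j < k)
    (hRj : R ⊆ Set.range (e j) ×ˢ Set.range (e j)) :
    ∃ R' ⊇ R, IsElementaryRel L R' ∧ R' ⊆ Set.range (e k) ×ˢ Set.range (e k) ∧
      ∀ a ∈ Set.range (e j), ∃ b, (a, b) ∈ R' := by
  classical
  have : Nonempty M := (he.nonempty j).map (e j)
  choose r hr using fun p : R => (hRj p.2).2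
  let ρ : X j ⊕ R → X j ⊕ X j := Sum.elim Sum.inr (Sum.inl ∘ r)
  have hρ : ∀ w : X j → M, Sum.elim (e j) w ∘ ρ = Sum.elim w fun p : R => p.1.2 := by
    intro w
    ext (x | p)
    · rfl
    · exact hr p
  -- the type of the stage over the domain of `R`, to be realized over the range of `R`
  let T : Set (L.Formula (X j ⊕ R)) := {φ | φ.Realize (Sum.elim (e j) fun p : R => p.1.1)}
  obtain ⟨w, hw⟩ := he.exists_realize j k hjk ((fun φ => φ.relabel ρ) '' T) (by
    intro s hs hfin
    choose φ hφT hφ using hs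
    have := hfin.to_subtype
    let χ : L.Formula (X j ⊕ R) := Formula.iInf fun ψ : s => φ ψ.2
    obtain ⟨θ, hθ⟩ := χ.exists_realize_iff_exists
    have h1 : θ.Realize fun p : R => p.1.1 :=
      (hθ M _).2 ⟨e j, Formula.realize_iInf.2 fun ψ => hφT ψ.2⟩
    obtain ⟨w, hw⟩ := (hθ M _).1 ((hR.realize_iff θ id).1 h1)
    refine ⟨w, fun ψ hψ => ?_⟩
    rw [← hφ hψ]
    change (Formula.relabel ρ _).Realize _
    rw [Formula.realize_relabel, hρ]
    exact Formula.realize_iInf.1 hw ⟨ψ, hψ⟩)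
  have hT : ∀ φ ∈ T, φ.Realize (Sum.elim (e k ∘ w) fun p : R => p.1.2) := by
    intro φ hφ
    have := hw _ ⟨φ, hφ, rfl⟩
    change (Formula.relabel ρ _).Realize _ at this
    rwa [Formula.realize_relabel, hρ] at this
  refine ⟨Set.range fun z : X j ⊕ R => (Sum.elim (e j) (fun p : R => p.1.1) z,
    Sum.elim (e k ∘ w) (fun p : R => p.1.2) z), fun p hp => ⟨Sum.inr ⟨p, hp⟩, rfl⟩,
    isElementaryRel_range fun φ => ⟨hT φ, fun h => ?_⟩, ?_, ?_⟩
  · by_contra hcon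
    exact hT (∼φ) hcon h
  · rintro _ ⟨x | p, rfl⟩
    · exact ⟨he.range_mono j k hjk.le ⟨x, rfl⟩, ⟨w x, rfl⟩⟩
    · exact ⟨he.range_mono j k hjk.le (hRj p.2).1, he.range_mono j k hjk.le (hRj p.2).2⟩
  · rintro _ ⟨x, rfl⟩
    exact ⟨e k (w x), Sum.inl x, rfl⟩

/-- An elementary relation on one stage. -/
def IsStageRel (L : FirstOrder.Language.{u, u}) [L.Structure M] (e : ∀ j, X j → M)
    (R : Set (M × M)) : Prop :=
  IsElementaryRel L R ∧ ∃ j, R ⊆ Set.range (e j) ×ˢ Set.range (e j)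

lemma IsRealizingChain.exists_extend [NoMaxOrder J] (he : IsRealizingChain L e)
    {R : Set (M × M)} (hR : IsStageRel L e R) (i : J) :
    ∃ R' ⊇ R, IsStageRel L e R' ∧
      ∀ a ∈ Set.range (e i), (∃ b, (a, b) ∈ R') ∧ ∃ b, (b, a) ∈ R' := by
  obtain ⟨hel, j, hj⟩ := hR
  obtain ⟨k, hk⟩ := exists_gt (max i j)
  obtain ⟨l, hl⟩ := exists_gt k
  obtain ⟨R₁, hR₁, hel₁, hk₁, hdom₁⟩ := he.exists_extend_left hel hk
    (hj.trans (Set.prod_mono (he.range_mono _ _ (le_max_right i j))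
      (he.range_mono _ _ (le_max_right i j))))
  obtain ⟨R₂, hR₂, hel₂, hk₂, hdom₂⟩ := he.exists_extend_left hel₁.swap hl
    (fun p hp => ⟨(hk₁ hp).2, (hk₁ hp).1⟩)
  refine ⟨Prod.swap ⁻¹' R₂, fun p hp => hR₂ (hR₁ hp), ⟨hel₂.swap, l, fun p hp =>
    ⟨(hk₂ hp).2, (hk₂ hp).1⟩⟩, fun a ha => ⟨?_, ?_⟩⟩
  · obtain ⟨b, hb⟩ := hdom₁ a (he.range_mono _ _ (le_max_left i j) ha)
    exact ⟨b, hR₂ hb⟩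
  · exact hdom₂ a (he.range_mono _ _ ((le_max_left i j).trans hk.le) ha)

end ElementaryRelation

/-- Transfinite iteration of extensions: if a property of sets passes to unions of small chains
and every set with the property can be extended so as to meet the demand of any given index,
then there is an increasing family that meets all the demands. -/
lemma exists_monotone_of_extensions {J T : Type u} [LinearOrder J] [WellFoundedLT J]
    {κ : Cardinal.{u}} (hκ : ℵ₀ ≤ κ) (hJ : ∀ i : J, #(Set.Iio i) ≤ κ)
    {good : Set T → Prop} {demand : J → Set T → Prop} {R₀ : Set T} (h₀ : good R₀)
    (hext : ∀ R i, good R → ∃ R' ⊇ R, good R' ∧ demand i R')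
    (hchain : ∀ C : Set (Set T), C.Nonempty → IsChain (· ⊆ ·) C → #C ≤ κ →
      (∀ R ∈ C, good R) → good (⋃₀ C)) :
    ∃ F : J → Set T, Monotone F ∧ ∀ i, R₀ ⊆ F i ∧ good (F i) ∧ demand i (F i) := by
  classical
  choose! E hE using fun R (hR : good R) i => hext R i hR
  let F : J → Set T := WellFounded.fix (wellFounded_lt (α := J)) fun i F =>
    E (⋃₀ insert R₀ (Set.range fun k : Set.Iio i => F k.1 k.2)) i
  have hF : ∀ i, F i = E (⋃₀ insert R₀ (Set.range fun k : Set.Iio i => F k.1)) i := fun i =>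
    WellFounded.fix_eq _ _ i
  have key : ∀ i, good (⋃₀ insert R₀ (Set.range fun k : Set.Iio i => F k.1)) := by
    intro i
    induction i using WellFoundedLT.induction with
    | ind i ih =>
      have hR₀ : ∀ k < i, R₀ ⊆ F k := fun k hk => by
        rw [hF]
        exact (Set.subset_sUnion_of_mem (Set.mem_insert _ _)).trans (hE _ (ih k hk) k).1
      have hmono : ∀ k < i, ∀ l < k, F l ⊆ F k := fun k hk l hl => by
        conv_rhs => rw [hF]
        refine Set.Subset.trans ?_ (hE _ (ih k hk) k).1
        exact Set.subset_sUnion_of_mem (Set.mem_insert_of_mem _ ⟨⟨l, hl⟩, rfl⟩)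
      refine hchain _ (Set.insert_nonempty _ _) ?_ ?_ ?_
      · refine IsChain.insert ?_ ?_
        · rintro _ ⟨⟨k, hk⟩, rfl⟩ _ ⟨⟨l, hl⟩, rfl⟩ _
          rcases lt_trichotomy k l with h | rfl | h
          · exact Or.inl (hmono l hl k h)
          · exact Or.inl subset_rfl
          · exact Or.inr (hmono k hk l h)
        · rintro _ ⟨⟨k, hk⟩, rfl⟩ _
          exact Or.inl (hR₀ k hk)
      · refine mk_insert_le.trans ?_
        exact add_le_of_le hκ (mk_range_le.trans (hJ i)) (one_le_aleph0.trans hκ)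
      · rintro _ (rfl | ⟨⟨k, hk⟩, rfl⟩)
        · exact h₀
        · change good (F k)
          rw [hF]
          exact (hE _ (ih k hk) k).2.1
  refine ⟨F, ?_, fun i => ⟨?_, ?_⟩⟩
  · intro k i hki
    rcases hki.eq_or_lt with rfl | hlt
    · exact le_rfl
    · conv_rhs => rw [hF]
      refine Set.Subset.trans ?_ (hE _ (key i) i).1
      exact Set.subset_sUnion_of_mem (Set.mem_insert_of_mem _ ⟨⟨k, hlt⟩, rfl⟩)
  · rw [hF]
    exact (Set.subset_sUnion_of_mem (Set.mem_insert _ _)).trans (hE _ (key i) i).1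
  · rw [hF]
    exact (hE _ (key i) i).2

/-! ### Existence of monster models -/

section Existence

variable {L : FirstOrder.Language.{u, u}} {M : Type u} [L.Structure M] {κ : Cardinal.{u}}
  {J : Type u} [LinearOrder J] {X : J → Type u} {e : ∀ j, X j → M}

lemma IsRealizingChain.exists_range_subset [NoMaxOrder J] (he : IsRealizingChain L e)
    (hcov : ∀ a, ∃ j, a ∈ Set.range (e j))
    (hJ : ∀ (ι : Type u) (f : ι → J), #ι ≤ κ → ∃ j, ∀ i, f i < j) {ι : Type u} (hι : #ι ≤ κ)
    (f : ι → M) : ∃ j, ∀ i, f i ∈ Set.range (e j) := by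
  choose g hg using fun i => hcov (f i)
  obtain ⟨j, hj⟩ := hJ ι g hι
  exact ⟨j, fun i => he.range_mono _ _ (hj i).le (hg i)⟩

lemma IsRealizingChain.isSaturatedModel [NoMaxOrder J] (he : IsRealizingChain L e)
    (hcov : ∀ a, ∃ j, a ∈ Set.range (e j))
    (hJ : ∀ (ι : Type u) (f : ι → J), #ι ≤ κ → ∃ j, ∀ i, f i < j) :
    IsSaturatedModel L M κ := by
  intro B hB p hp
  obtain ⟨j, hj⟩ := he.exists_range_subset hcov hJ hB.le fun b : B => (b : M)
  choose r hr using hj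
  obtain ⟨k, hk⟩ := exists_gt j
  obtain ⟨x₀⟩ := he.nonempty j
  have key : ∀ (φ : L.Formula (B ⊕ Unit)) (w : X j → M),
      (φ.relabel (Sum.map r fun _ => x₀)).Realize (Sum.elim (e j) w) ↔
        φ.Realize (Sum.elim (fun b : B => (b : M)) fun _ => w x₀) := by
    intro φ w
    rw [Formula.realize_relabel, Sum.elim_comp_map, show e j ∘ r = fun b : B => (b : M) from
      funext hr]
    rfl
  obtain ⟨w, hw⟩ := he.exists_realize j k hk
    ((fun φ : L.Formula (B ⊕ Unit) => φ.relabel (Sum.map r fun _ => x₀)) '' p) (by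
      intro s hs hfin
      choose φ hφp hφ using hs
      have := hfin.to_subtype
      obtain ⟨a, ha⟩ := hp (Set.range fun ψ : s => φ ψ.2)
        (by rintro _ ⟨ψ, rfl⟩; exact hφp ψ.2) (Set.finite_range _)
      refine ⟨fun _ => a, fun ψ hψ => ?_⟩
      rw [← hφ hψ]
      exact (key _ _).2 (ha _ ⟨⟨ψ, hψ⟩, rfl⟩))
  exact ⟨_, fun φ hφ => (key _ _).1 (hw _ ⟨φ, hφ, rfl⟩)⟩

lemma IsRealizingChain.isStronglyHomogeneous [NoMaxOrder J] [WellFoundedLT J]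
    (he : IsRealizingChain L e) (hκ : ℵ₀ ≤ κ) (hcov : ∀ a, ∃ j, a ∈ Set.range (e j))
    (hJ : ∀ (ι : Type u) (f : ι → J), #ι ≤ κ → ∃ j, ∀ i, f i < j)
    (hIio : ∀ i : J, #(Set.Iio i) ≤ κ) : IsStronglyHomogeneous L M κ := by
  intro B f hB hf
  obtain ⟨F, hmono, hF⟩ := exists_monotone_of_extensions hκ hIio (good := IsStageRel L e)
    (demand := fun i R => ∀ a ∈ Set.range (e i), (∃ b, (a, b) ∈ R) ∧ ∃ b, (b, a) ∈ R)
    (R₀ := Set.range fun b : B => ((b : M), f b)) (by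
      refine ⟨isElementaryRel_range hf, ?_⟩
      obtain ⟨j, hj⟩ := he.exists_range_subset hcov hJ (ι := B ⊕ B)
        (by simpa using add_le_of_le hκ hB.le hB.le) (Sum.elim (fun b => b) f)
      refine ⟨j, ?_⟩
      rintro _ ⟨b, rfl⟩
      exact ⟨hj (Sum.inl b), hj (Sum.inr b)⟩)
    (fun R i hR => he.exists_extend hR i)
    (fun C hne hchain hcard hgood => by
      refine ⟨isElementaryRel_sUnion hne hchain fun R hR => (hgood R hR).1, ?_⟩
      choose m hm using fun R : C => (hgood R R.2).2
      obtain ⟨j, hj⟩ := hJ C m hcard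
      refine ⟨j, Set.sUnion_subset fun R hR => (hm ⟨R, hR⟩).trans ?_⟩
      exact Set.prod_mono (he.range_mono _ _ (hj ⟨R, hR⟩).le) (he.range_mono _ _ (hj ⟨R, hR⟩).le))
  obtain ⟨j₀, -⟩ := hJ PEmpty PEmpty.elim (by simp)
  have hel : IsElementaryRel L (⋃₀ Set.range F) := by
    refine isElementaryRel_sUnion ⟨_, j₀, rfl⟩ ?_ ?_
    · exact hmono.isChain_range
    · rintro _ ⟨i, rfl⟩
      exact (hF i).2.1.1
  obtain ⟨σ, hσ⟩ := hel.exists_equiv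
    (fun a => by
      obtain ⟨i, hi⟩ := hcov a
      obtain ⟨b, hb⟩ := ((hF i).2.2 a hi).1
      exact ⟨b, _, ⟨i, rfl⟩, hb⟩)
    (fun a => by
      obtain ⟨i, hi⟩ := hcov a
      obtain ⟨b, hb⟩ := ((hF i).2.2 a hi).2
      exact ⟨b, _, ⟨i, rfl⟩, hb⟩)
  exact ⟨σ, fun b => (hel.eq_iff (hσ b) ⟨_, ⟨j₀, rfl⟩, (hF j₀).1 ⟨b, rfl⟩⟩).1 rfl⟩

end Existence

/-- There are well-orders in which all subsets of a given infinite size are bounded, while the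
proper initial segments are not larger than that size. -/
lemma exists_wellOrder_bounded {κ : Cardinal.{u}} (hκ : ℵ₀ ≤ κ) :
    ∃ (J : Type u) (_ : LinearOrder J), WellFoundedLT J ∧ Nonempty J ∧ NoMaxOrder J ∧
      (∀ (ι : Type u) (f : ι → J), #ι ≤ κ → ∃ j, ∀ i, f i < j) ∧
        ∀ i : J, #(Set.Iio i) ≤ κ := by
  have hbdd : ∀ (ι : Type u) (f : ι → (Order.succ κ).ord.ToType), #ι ≤ κ → ∃ j, ∀ i, f i < j := by
    intro ι f hι
    have hcof : ¬ IsCofinal (Set.range f) := fun hc => by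
      have h1 := Order.cof_le hc
      rw [Ordinal.cof_toType, (isRegular_succ hκ).cof_ord] at h1
      exact absurd (h1.trans (mk_range_le.trans hι)) (not_le.2 (Order.lt_succ κ))
    obtain ⟨j, hj⟩ := not_isCofinal_iff.1 hcof
    exact ⟨j, fun i => hj _ ⟨i, rfl⟩⟩
  refine ⟨(Order.succ κ).ord.ToType, inferInstance, inferInstance, ?_,
    Cardinal.noMaxOrder (hκ.trans (Order.le_succ κ)), hbdd, fun i => ?_⟩
  · obtain ⟨j, -⟩ := hbdd PEmpty PEmpty.elim (by simp)
    exact ⟨j⟩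
  · exact Order.lt_succ_iff.1 (by simpa using Cardinal.mk_Iio_lt i (by simp))

lemma exists_isStrongLimit_gt (c : Cardinal.{u}) :
    ∃ κ : Cardinal.{u}, κ.IsStrongLimit ∧ ℵ₀ < κ ∧ c < κ := by
  have ho : Order.IsSuccLimit (c.ord + Ordinal.omega0) :=
    Ordinal.isSuccLimit_add _ Ordinal.isSuccLimit_omega0
  have h1 : c.ord < c.ord + Ordinal.omega0 := by simp [Ordinal.omega0_pos]
  refine ⟨beth (c.ord + Ordinal.omega0), isStrongLimit_beth.2 ho.isSuccPrelimit, ?_, ?_⟩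
  · exact (aleph0_le_beth c.ord).trans_lt (beth_strictMono h1)
  · exact (le_beth_ord c).trans_lt (beth_strictMono h1)

/-- The group laws pass to an elementary extension of an expansion of a group. -/
lemma FirstOrder.Language.ElementaryEmbedding.exists_group {L : FirstOrder.Language.{u, u}}
    {G M : Type u} [Group G] [L.Structure G] [L.Structure M] (f : G ↪ₑ[L] M) {m : L.Functions 2}
    (hm : ∀ a b : G, funMap m ![a, b] = a * b) :
    ∃ _ : Group M, ∀ a b : M, funMap m ![a, b] = a * b := by
  have hassoc : ∀ a b c : M,
      funMap m ![funMap m ![a, b], c] = funMap m ![a, funMap m ![b, c] ] := by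
    intro a b c
    by_contra hcon
    obtain ⟨v, hv⟩ := f.exists_realize (v := ![a, b, c])
      (∼((m.apply₂ (m.apply₂ (Term.var 0) (Term.var 1)) (Term.var 2)).equal
        (m.apply₂ (Term.var 0) (m.apply₂ (Term.var 1) (Term.var 2)))))
      (by simpa [Formula.realize_not, Formula.realize_equal] using hcon)
    simp [Formula.realize_not, Formula.realize_equal, hm, mul_assoc] at hv
  have hf1 : funMap m ![f 1, f 1] = f 1 := by
    have := f.map_fun m ![1, 1]
    rw [hm, mul_one] at this
    refine Eq.trans (congrArg _ ?_) this.symm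
    ext i
    fin_cases i <;> rfl
  -- the identity of the group is its only idempotent
  have hone : ∀ a : M, funMap m ![f 1, a] = a := by
    intro a
    by_contra hcon
    obtain ⟨v, hv⟩ := f.exists_realize (v := ![f 1, a])
      (((m.apply₂ (Term.var 0) (Term.var 0)).equal (Term.var 0)) ⊓
        ∼((m.apply₂ (Term.var 0) (Term.var 1)).equal (Term.var 1)))
      (by simpa [Formula.realize_not, Formula.realize_equal, hf1] using hcon)
    simp [Formula.realize_not, Formula.realize_equal, hm] at hv
  have hinv : ∀ a : M, ∃ b, funMap m ![b, a] = f 1 := by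
    intro a
    by_contra hcon
    obtain ⟨v, hv⟩ := f.exists_realize (v := ![f 1, a])
      (((m.apply₂ (Term.var 0) (Term.var 0)).equal (Term.var 0)) ⊓
        ∼(((m.apply₂ (Term.var (Sum.inr ())) (Term.var (Sum.inl 1))).equal
          (Term.var (Sum.inl 0)) : L.Formula (Fin 2 ⊕ Unit)).iExs Unit))
      (by
        rw [Formula.realize_inf, Formula.realize_not, Formula.realize_iExs]
        refine ⟨by simpa [Formula.realize_equal] using hf1, fun ⟨i, hi⟩ => hcon ⟨i (), ?_⟩⟩
        simpa [Formula.realize_equal] using hi)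
    rw [Formula.realize_inf, Formula.realize_not, Formula.realize_iExs] at hv
    refine hv.2 ⟨fun _ => v 0 * (v 1)⁻¹, ?_⟩
    simp [Formula.realize_equal, hm]
  choose i hi using hinv
  let : Mul M := ⟨fun a b => funMap m ![a, b]⟩
  let : One M := ⟨f 1⟩
  let : Inv M := ⟨i⟩
  exact ⟨Group.ofLeftAxioms hassoc hone hi, fun _ _ => rfl⟩

theorem GroupExpansion.nonempty_monsterModel {G : Type u} [Group G] (E : GroupExpansion G) :
    Nonempty (MonsterModel E) := by
  obtain ⟨κ, hlim, hκ, hc⟩ := exists_isStrongLimit_gt (max E.L.card #G)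
  obtain ⟨J, _, _, _, _, hbdd, hIio⟩ := exists_wellOrder_bounded hκ.le
  obtain ⟨M, _, f, X, e, he, hcov⟩ :=
    exists_elementaryEmbedding_isRealizingChain_covering E.L G J
  obtain ⟨_, hmul⟩ := f.exists_group E.funMap_mul
  exact ⟨{
    κ := κ
    isStrongLimit := hlim
    aleph0_lt := hκ
    card_language_lt := (le_max_left _ _).trans_lt hc
    card_group_lt := (le_max_right _ _).trans_lt hc
    carrier := M
    funMap_mul := hmul
    embedding := f
    isSaturated := he.isSaturatedModel hcov hbdd
    isStronglyHomogeneous := he.isStronglyHomogeneous hκ.le hcov hbdd hIio }⟩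

/-! ### Absolutely connected groups have sequential width -/

section FullExpansion

/-- The only function symbol: multiplication. -/
inductive FullFunctions : ℕ → Type u
  | mul : FullFunctions 2

/-- The relation symbols: a unary one for every subset. -/
inductive FullRelations (Γ : Type u) : ℕ → Type u
  | mem (P : Set Γ) : FullRelations Γ 1

/-- The language with a symbol for multiplication and a predicate for every subset of `Γ`. -/
def fullLanguage (Γ : Type u) : FirstOrder.Language.{u, u} := ⟨FullFunctions, FullRelations Γ⟩

/-- The expansion of `Γ` by predicates for all of its subsets. -/
def fullExpansion (Γ : Type u) [Group Γ] : GroupExpansion Γ where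
  L := fullLanguage Γ
  str :=
    { funMap := fun {_} f x => match f, x with
        | FullFunctions.mul, x => x 0 * x 1
      RelMap := fun {_} r x => match r, x with
        | FullRelations.mem P, x => x 0 ∈ P }
  mul := FullFunctions.mul
  funMap_mul := fun _ _ => rfl

variable {Γ : Type u} [Group Γ]

/-- The formula saying that the distinguished variable belongs to `P`. -/
def memFormula (P : Set Γ) : (fullExpansion Γ).L.Formula (PEmpty.{u + 1} ⊕ Unit) :=
  Relations.formula₁ (L := (fullExpansion Γ).L) (FullRelations.mem P) (Term.var (Sum.inr ()))

lemma realize_memFormula (P : Set Γ) (y : PEmpty.{u + 1} → Γ) (a : Γ) :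
    (memFormula P).Realize (Sum.elim y fun _ => a) ↔ a ∈ P :=
  Formula.realize_rel₁

/-- If `s` violates sequential width, then a monster model of the full expansion contains an
element outside the subgroup generated by the quotients of pairs of elements that satisfy the same
predicates; this subgroup is invariant and has bounded index. -/
theorem IsAbsolutelyConnected.hasSequentialWidth (h : IsAbsolutelyConnected Γ) :
    HasSequentialWidth Γ := by
  classical
  intro s hs
  by_contra! hcon
  obtain ⟨M⟩ := (fullExpansion Γ).nonempty_monsterModel
  let y : PEmpty.{u + 1} → M.carrier := PEmpty.elim
  let S : ℕ → Set ((fullExpansion Γ).L.Formula (PEmpty.{u + 1} ⊕ Unit)) :=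
    fun n => memFormula '' s n
  have hS : ∀ n, Finite (S n) := fun n => ((hs n).image _).to_subtype
  obtain ⟨g, hg⟩ := M.isSaturated.exists_realize (Y := PEmpty.{u + 1})
    (by simpa using aleph0_pos.trans M.aleph0_lt) y
    (fun n => ∼(powFormula (fullExpansion Γ).mul (S n) n)) (by
      intro t
      obtain ⟨a, ha⟩ := hcon (t.sup id)
      refine ⟨M.embedding a, fun n hn => ?_⟩
      have h1 : Formula.Realize (∼(powFormula (fullExpansion Γ).mul (S n) n))
          (Sum.elim PEmpty.elim fun _ => a) := by
        rw [Formula.realize_not, realize_powFormula (fullExpansion Γ).funMap_mul]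
        refine fun hmem => ha n (Finset.le_sup (f := id) hn) (quotientSet_pow_mono ?_ n hmem)
        intro b c hbc P hP
        have := hbc _ ⟨P, hP, rfl⟩
        rwa [realize_memFormula, realize_memFormula] at this
      rw [← M.embedding.map_formula] at h1
      convert h1 using 1
      ext (z | z)
      · exact z.elim
      · rfl)
  let r : M.carrier → M.carrier → Prop := SameType (Set.range (memFormula (Γ := Γ))) y
  let K : Subgroup M.carrier := Subgroup.closure (quotientSet r)
  have hr : ∀ {a b}, r a b → a⁻¹ * b ∈ K := fun {a b} hab =>
    Subgroup.subset_closure ⟨a, b, hab, mul_inv_cancel_left a b⟩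
  have hK : K ∈ M.boundedInvariantSubgroups ∅ := by
    refine ⟨?_, fun σ _ x hx => ?_⟩
    -- a coset is determined by the predicates that a representative satisfies
    · let ty : M.carrier → Set (Set Γ) := fun a =>
        {P | (memFormula P).Realize (Sum.elim y fun _ => a)}
      have hinj : Function.Injective fun q : M.carrier ⧸ K => ty q.out := by
        intro p q hpq
        rw [← QuotientGroup.out_eq' p, ← QuotientGroup.out_eq' q]
        refine QuotientGroup.eq.2 (hr ?_)
        rintro _ ⟨P, rfl⟩
        exact Set.ext_iff.1 hpq P
      refine (mk_le_of_injective hinj).trans_lt ?_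
      rw [mk_set, mk_set]
      exact M.isStrongLimit.isStrongPrelimit (M.isStrongLimit.isStrongPrelimit M.card_group_lt)
    · have hle : K ≤ K.comap (MonoidHom.mk' σ (M.map_mul σ)) := by
        refine (Subgroup.closure_le _).2 ?_
        rintro z ⟨a, b, hab, rfl⟩
        refine Subgroup.subset_closure ⟨σ a, σ (a * z), fun φ hφ => ?_, (M.map_mul σ a z).symm⟩
        have hσ : ∀ c, φ.Realize (Sum.elim y fun _ => σ c) ↔
            φ.Realize (Sum.elim y fun _ => c) := fun c => by
          refine Iff.trans (iff_of_eq (congrArg _ ?_))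
            (StrongHomClass.realize_formula σ φ (v := Sum.elim y fun _ => c))
          ext (z | z)
          · exact z.elim
          · rfl
        rw [hσ, hσ]
        exact hab φ hφ
      exact hle hx
  have hgK : g ∈ K := ((h.2 (fullExpansion Γ)).2 M ∅
    (by simpa using aleph0_pos.trans M.aleph0_lt)).2 hK (Subgroup.mem_top g)
  obtain ⟨n, hn⟩ := exists_mem_pow_of_mem_closure
    (fun a b hab φ hφ => (hab φ hφ).symm) hgK
  refine hg n ((realize_powFormula M.funMap_mul (S n) y n g).2 (quotientSet_pow_mono ?_ n hn))
  rintro a b hab _ ⟨P, -, rfl⟩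
  exact hab _ ⟨P, rfl⟩

end FullExpansion

theorem isAbsolutelyConnected_iff_hasUniformWidth {Γ : Type u} [Group Γ] :
    IsAbsolutelyConnected Γ ↔ Infinite Γ ∧ HasUniformWidth Γ :=
  ⟨fun h => ⟨h.1, h.hasSequentialWidth.hasUniformWidth⟩,
    fun ⟨_, h⟩ => h.isAbsolutelyConnected⟩

theorem mainTheorem11 {G H : Type u} {A : Type v} [Group G] [Group H] [AddCommGroup A] [Finite A]
    [DistribMulAction G A] (h : TwoCocycle G A) (S : GroupExtension (Multiplicative A) H G)
    (hS : Nonempty (S.Equiv h.extension)) (hns : h.IsStronglyNonSplit) :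
    (HasNoProperFiniteIndexSubgroup G ↔ HasNoProperFiniteIndexSubgroup H) ∧
      (IsAbsolutelyConnected G ↔ IsAbsolutelyConnected H) := by
  obtain ⟨e⟩ := hS
  have hπ := S.rightHom_surjective
  have hker : (S.rightHom.ker : Set H) = Set.range S.inl := by
    rw [← S.range_inl_eq_ker_rightHom, MonoidHom.coe_range]
  have hfin : (S.rightHom.ker : Set H).Finite := by
    have : Finite (Multiplicative A) := ‹Finite A›
    rw [hker]
    exact Set.finite_range _
  have hab : ∀ x ∈ S.rightHom.ker, ∀ y ∈ S.rightHom.ker, x * y = y * x := by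
    intro x hx y hy
    rw [← S.range_inl_eq_ker_rightHom] at hx hy
    obtain ⟨a, rfl⟩ := hx
    obtain ⟨b, rfl⟩ := hy
    rw [← map_mul, mul_comm, map_mul]
  have hnsπ := hns.rightHom S e
  have hinf : Infinite G ↔ Infinite H := by
    refine ⟨fun _ => Infinite.of_surjective _ hπ, fun hH => ?_⟩
    by_contra hG
    have : Finite G := not_infinite_iff_finite.1 hG
    have hinj : Function.Injective fun x : H =>
        ((e.toMulEquiv x).left, (e.toMulEquiv x).right) := fun x y hxy =>
      e.toMulEquiv.injective (TwoCocycle.Ext.ext (congrArg Prod.fst hxy) (congrArg Prod.snd hxy))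
    exact hH.not_finite (Finite.of_injective _ hinj)
  refine ⟨⟨.of_isStronglyNonSplitHom hπ hab hnsπ, .of_surjective hπ⟩, ?_⟩
  rw [isAbsolutelyConnected_iff_hasUniformWidth, isAbsolutelyConnected_iff_hasUniformWidth, hinf]
  exact and_congr_right fun _ =>
    ⟨.of_isStronglyNonSplitHom hπ hfin hab hnsπ, .of_surjective hπ⟩
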